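/- There is an absolute constant $C'>0$, and for every $1<p<\infty$ and $t\in(0,1]$ there is a constant $c=c(t,p)\ge 1$, such that the following holds. Let $\Omega\subset\mathbb R^d$ be compact with a Borel probability measure $\mu$, let $q=\min(p,2)$, $q'=q/(q-1)$, and let $1\le v_0\le u\le S\le N$ be integers. Let $\mathcal D_N=\{g_i\}_{i=1}^N$ be a system of continuous (real or complex valued) functions on $\Omega$ that has the $(v_0,S)$-incoherence property in $L_p(\Omega,\mu)$ with parameters $V,r>0$: $$\sum_{i\in A}|c_i|\le V|A|^r\Big\|\sum_{i\in B}c_ig_i\Big\|_{L_p(\Omega,\mu)}\quad\text{whenever } A\subset B\subset\{1,\dots,N\},\ |A|\le v_0,\ |B|\le S,\ \text{and the } c_i \text{ are scalars}.$$ Let $\xi=\{\xi^1,\dots,\xi^m\}\subset\Omega$ provide the $L_p$-universal sampling discretization for the spans of $u$ elements of $\mathcal D_N$: $$\tfrac12\|f\|_{L_p(\Omega,\mu)}^p\le\frac1m\sum_{j=1}^m|f(\xi^j)|^p\le\tfrac32\|f\|_{L_p(\Omega,\mu)}^p\quad\text{for every } f\in\operatorname{span}\{g_j:j\in J\},\ |J|=u.$$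 Put $\mu_m=\frac1m\sum_{j=1}^m\delta_{\xi^j}$, $\Omega_m=\{\xi^1,\dots,\xi^m\}$, $L_p^m=L_p(\Omega_m,\mu_m)$ and $\mu_\xi=\frac12(\mu+\mu_m)$. Assume that the system is normalized: for each $i$, $\|g_i\|_{L_p(\Omega,\mu)}\le1$ or $\|g_i\|_{L_p^m}\le 1$. Let $v$ be an integer with $1\le v\le v_0$ and $$v+a(v)\le u,\qquad a(v):=\big\lceil c\,(2Vv^r)^{q'}\ln(2Vv)\big\rceil .$$ Then for every continuous $f_0$ on $\Omega$ and every realization of the Weak Chebyshev Greedy Algorithm (WCGA) with weakness parameter $t$ for the restricted system $\mathcal D_N(\Omega_m)$ in $L_p^m$, applied to $f_0|_{\Omega_m}$, $$\Big\|f_0-G^t_{a(v)}(f_0,\mathcal D_N)_{L_p^m}\Big\|_{L_p(\Omega,\mu)}\le C'\,\sigma_v(f_0,\mathcal D_N)_{L_p(\Omega,\mu_\xi)} .$$ Here $\sigma_v(f_0,\mathcal D_N)_X$ is the distance in $X$ from $f_0$ to the set of linear combinations of $v$ elements of $\mathcal D_N$. The WCGA starts from $G_0=0$; at step $k\ge1$,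 if the residual $f_{k-1}=f_0-G_{k-1}$ is nonzero in $X=L_p^m$, one takes a functional $F\in X^*$ with $\|F\|=1$, $F(f_{k-1})=\|f_{k-1}\|_X$, and chooses any $\phi_k$ in the system with $|F(\phi_k)|\ge t\sup_g|F(g)|$ (if $f_{k-1}=0$ in $X$, any $\phi_k$ may be chosen); then $G_k$ is a best approximant in $X$ to $f_0$ from $\operatorname{span}\{\phi_1,\dots,\phi_k\}$. On the left-hand side $G^t_{a(v)}$ is the linear combination on $\Omega$ of the chosen functions of $\mathcal D_N$ whose restriction to $\Omega_m$ is the $a(v)$-th approximant of the algorithm. -/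

import Mathlib

open MeasureTheory
open scoped NNReal ENNReal

noncomputable section

namespace GreedySampling

section Normed

variable {𝕜 : Type*} [RCLike 𝕜] {X : Type*} [NormedAddCommGroup X] [NormedSpace 𝕜 X]
  {ι : Type*}

variable (𝕜) in
/-- The collection `𝒳_v(𝒟)` of the spaces `span {g_j : j ∈ J}` with `|J| = v`. (Only the linear
structure of the ambient space is used.) -/
def spans {E : Type*} [AddCommGroup E] [Module 𝕜 E] (v : ℕ) (g : ι → E) :
    Set (Submodule 𝕜 E) :=
  {W | ∃ J : Finset ι, J.card = v ∧ W = Submodule.span 𝕜 (g '' (J : Set ι))}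

variable (𝕜) in
/-- The set `Σ_v(𝒟)` of all `v`-term approximants. -/
def sparse {E : Type*} [AddCommGroup E] [Module 𝕜 E] (v : ℕ) (g : ι → E) : Set E :=
  {h | ∃ W ∈ spans 𝕜 v g, h ∈ W}

variable (𝕜) in
/-- Best `v`-term approximation `σ_v(f, 𝒟)_X`, the distance from `f` to `Σ_v(𝒟)`. -/
def sigma (v : ℕ) (g : ι → X) (f : X) : ℝ :=
  Metric.infDist f (sparse 𝕜 v g)

variable (𝕜) in
/-- The `(v, S)`-incoherence property with parameters `V` and `r` in the normed space `X`. -/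
def Incoherent (v S : ℕ) (V r : ℝ) (g : ι → X) : Prop :=
  ∀ A B : Finset ι, A ⊆ B → A.card ≤ v → B.card ≤ S → ∀ c : ι → 𝕜,
    ∑ i ∈ A, ‖c i‖ ≤ V * (A.card : ℝ) ^ r * ‖∑ i ∈ B, c i • g i‖

variable (𝕜) in
/-- The span `Φ(k)` of the first `k` chosen elements (`φ j` is the index chosen at step `j + 1`). -/
def chosenSpan {E : Type*} [AddCommGroup E] [Module 𝕜 E] (g : ι → E) (φ : ℕ → ι) (k : ℕ) :
    Submodule 𝕜 E :=
  Submodule.span 𝕜 ((fun j => g (φ j)) '' {j | j < k})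

variable (𝕜) in
/-- `φ`, `G` is a realization of the Weak Chebyshev Greedy Algorithm with weakness parameter `t`
for the system `g`, applied to `f₀` in the normed space `X`: `φ k` is the index of the element
chosen at step `k + 1`, and `G k` is the approximant after `k` steps. If the residual
`f₀ - G k` vanishes, no restriction is put on the later choices. -/
structure IsWCGA (t : ℝ) (g : ι → X) (f₀ : X) (φ : ℕ → ι) (G : ℕ → X) : Prop where
  /-- The chosen element is weakly greedy for a norming functional `F` of the residual. -/
  greedy : ∀ k, f₀ - G k ≠ 0 → ∃ F : StrongDual 𝕜 X,
    ‖F‖ = 1 ∧ F (f₀ - G k) = ((‖f₀ - G k‖ : ℝ) : 𝕜) ∧ ∀ i, t * ‖F (g i)‖ ≤ ‖F (g (φ k))‖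
  mem : ∀ k, G k ∈ chosenSpan 𝕜 g φ k
  /-- `G k` is a best approximant to `f₀` from `Φ(k)`. -/
  best : ∀ k, ∀ h ∈ chosenSpan 𝕜 g φ k, ‖f₀ - G k‖ ≤ ‖f₀ - h‖

end Normed

section Sampling

variable {α : Type*} [MeasurableSpace α]

/-- The measure `μ_m = (1/m) ∑ⱼ δ_{ξʲ}`; `L_p(Ω_m, μ_m)` is `L_p` of this measure. -/
def sampleMeasure {m : ℕ} (ξ : Fin m → α) : Measure α :=
  (m : ℝ≥0)⁻¹ • ∑ j, Measure.dirac (ξ j)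

instance {m : ℕ} (ξ : Fin m → α) : IsFiniteMeasure (sampleMeasure ξ) := by
  unfold sampleMeasure; infer_instance

/-- The measure `μ_ξ = (μ + μ_m) / 2`. -/
def mixedMeasure {m : ℕ} (μ : Measure α) (ξ : Fin m → α) : Measure α :=
  (2 : ℝ≥0)⁻¹ • (μ + sampleMeasure ξ)

instance {m : ℕ} (μ : Measure α) [IsFiniteMeasure μ] (ξ : Fin m → α) :
    IsFiniteMeasure (mixedMeasure μ ξ) := by
  unfold mixedMeasure; infer_instance

instance (p : ℝ) [hp : Fact (1 < p)] : Fact (1 ≤ ENNReal.ofReal p) :=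
  ⟨by simpa using ENNReal.ofReal_le_ofReal hp.out.le⟩

variable [TopologicalSpace α] [CompactSpace α] [BorelSpace α] {𝕜 : Type*} [RCLike 𝕜]

/-- A continuous function, regarded as an element of `L_p(ν)`. -/
abbrev toLp (p : ℝ) [Fact (1 < p)] (ν : Measure α) [IsFiniteMeasure ν] (f : C(α, 𝕜)) :
    Lp 𝕜 (ENNReal.ofReal p) ν :=
  ContinuousMap.toLp (ENNReal.ofReal p) ν 𝕜 f

/-- The points `ξ` provide the `L_p`-universal sampling discretization for the collection `𝒳`. -/
def UniversalDiscretization (p : ℝ) [Fact (1 < p)] (μ : Measure α) [IsFiniteMeasure μ] {m : ℕ}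
    (ξ : Fin m → α) (𝒳 : Set (Submodule 𝕜 C(α, 𝕜))) : Prop :=
  ∀ W ∈ 𝒳, ∀ f ∈ W,
    1 / 2 * ‖toLp p μ f‖ ^ p ≤ 1 / (m : ℝ) * ∑ j, ‖f (ξ j)‖ ^ p ∧
      1 / (m : ℝ) * ∑ j, ‖f (ξ j)‖ ^ p ≤ 3 / 2 * ‖toLp p μ f‖ ^ p

end Sampling

/-- The number of steps `a(v) = ⌈c (2 V v^r)^{q'} ln (2 V v)⌉`, where `q = min(p, 2)` and
`q' = q / (q - 1)`. -/
def stepCount (p c V r : ℝ) (v : ℕ) : ℕ :=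
  ⌈c * (2 * V * (v : ℝ) ^ r) ^ (min p 2 / (min p 2 - 1)) * Real.log (2 * V * v)⌉₊

end GreedySampling

end

/-!
Write `q = min p 2`, `q' = q / (q - 1)`, let `f = ∑_{i ∈ T} xᵢ gᵢ` be any combination of `v` elements
of the system, and let `ε` be the error `‖f₀ - f‖` in the discrete space `X = L_p^m`. The heart of
the matter is that the greedy algorithm brings the residual `ρ_k = ‖f₀ - G_k‖` down to `4 ε` in
`a(v)` steps (`norm_residual_le`). The discretization, applied to `f - G`, a combination of at most
`v + a(v) ≤ u` elements, then carries the estimate from `X` to `L_p(μ)`, and `‖f₀ - f‖` is at most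
twice its `L_p(μ_ξ)` norm in either space.

The space `X` enters only through the two-point inequality
`‖x + y‖ ^ q + ‖x - y‖ ^ q ≤ 2 ‖x‖ ^ q + 2 K ‖y‖ ^ q` (`PowerSmooth`, `powerSmooth_Lp`).
As long as `ρ_k > 4 ε`, put `M_k = ∑ |xᵢ|` over the indices in `T` that are not selected before step
`k + 1`, and `s_k = M_k / ρ_k`. A norming functional of the residual annihilates the chosen elements,
so it is at least of size `t / (2 s_k)` on the next chosen element, and smoothness gives
`log ρ_{k+1} ≤ log ρ_k - θ s_k ^ (-q')` (`IsWCGA.log_residual_succ_le`). Incoherence bounds `s_k` by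
`2 W` with `W = min (2 V v ^ r) (2 V v)`, but this alone does not bound the number of steps, since
`ρ_0 / ε` is arbitrary.

Instead, the steps are grouped by the dyadic level of `M_k`. Within a level `ρ_k` varies by a factor
of at most `16 W`, so that a level takes `O(log (16 W) max s_k ^ q')` steps
(`card_steps_le_of_levels`). The maxima over the levels are summable: if `M_k` at least halves
between the times in `E`, then `∑_{k ∈ E} s_k ^ q' = O(W ^ q')` (`IsWCGA.sum_ratio_rpow_le`). Indeed,
the vectors `f - G_k`, `k ∈ E`, have large coefficients on disjoint subsets of `T`, and the norm of a
combination of them with random signs grows only like an `ℓ_q` sum, since `PowerSmooth` implies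
type `q`; all these vectors involve only the `v + a(v)` elements to which incoherence applies at
once (`sum_coeff_rpow_le`). Summation over the even and the odd levels gives `O(W ^ q' log (16 W))`
steps. No relation between `r` and `q'` is needed. The normalization bounds `2 V` from below by
`2 ^ (1 - 1 / p) > 1`, so that `log (2 V v)` dominates constants (`lt_stepCount`).
-/

namespace GreedySampling

/-! ### Random signs in a space with a smooth norm -/

/-- The norm of `X` is smooth of power type `q` with constant `K`. For `1 < q ≤ 2` this two-point
inequality is equivalent, up to the constant, to the bound `ρ(u) = O(u ^ q)` on the modulus of
smoothness; it also gives type `q` (`sum_norm_signed_rpow_le`). -/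
def PowerSmooth (X : Type*) [NormedAddCommGroup X] (q K : ℝ) : Prop :=
  ∀ x y : X, ‖x + y‖ ^ q + ‖x - y‖ ^ q ≤ 2 * ‖x‖ ^ q + 2 * K * ‖y‖ ^ q

/-- The sign `±1` attached to `e` by the set `s`: averages over independent random signs are
written as averages over the subsets `s` of the index set. -/
def sgn (𝕜 : Type*) [One 𝕜] [Neg 𝕜] (s : Finset ℕ) (e : ℕ) : 𝕜 :=
  if e ∈ s then 1 else -1

section Signs

variable {𝕜 : Type*} [RCLike 𝕜] {X : Type*} [NormedAddCommGroup X] [NormedSpace 𝕜 X]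

/-- Splitting off the sign of one index. -/
theorem sum_powerset_insert_sgn {M : Type*} [AddCommMonoid M] {E : Finset ℕ} {a : ℕ}
    (ha : a ∉ E) (Φ : X → M) (x : X) (y : ℕ → X) :
    ∑ s ∈ (insert a E).powerset, Φ (x + ∑ e ∈ insert a E, sgn 𝕜 s e • y e) =
      ∑ s ∈ E.powerset, (Φ ((x + ∑ e ∈ E, sgn 𝕜 s e • y e) + y a) +
        Φ ((x + ∑ e ∈ E, sgn 𝕜 s e • y e) - y a)) := by
  rw [Finset.sum_powerset_insert ha, ← Finset.sum_add_distrib]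
  refine Finset.sum_congr rfl fun s hs => ?_
  have has : a ∉ s := fun h => ha (Finset.mem_powerset.1 hs h)
  rw [add_comm]
  congr 2
  · rw [Finset.sum_insert ha]
    have : ∑ e ∈ E, sgn 𝕜 (insert a s) e • y e = ∑ e ∈ E, sgn 𝕜 s e • y e := by
      refine Finset.sum_congr rfl fun e he => ?_
      have : e ≠ a := fun h => ha (h ▸ he)
      simp [sgn, this]
    rw [this]
    simp only [sgn, Finset.mem_insert_self, if_true, one_smul]
    abel
  · rw [Finset.sum_insert ha]
    simp only [sgn, has, if_false, neg_smul, one_smul]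
    abel

/-- Power smoothness implies type `q`: the average of `‖∑ ± y e‖ ^ q` over all signs is at most
`K ∑ ‖y e‖ ^ q`. The offset `x` is what the induction needs. -/
theorem sum_norm_signed_rpow_le {q K : ℝ} (hX : PowerSmooth X q K) (E : Finset ℕ) (x : X)
    (y : ℕ → X) :
    ∑ s ∈ E.powerset, ‖x + ∑ e ∈ E, sgn 𝕜 s e • y e‖ ^ q ≤
      2 ^ E.card * (‖x‖ ^ q + K * ∑ e ∈ E, ‖y e‖ ^ q) := by
  induction E using Finset.induction_on with
  | empty => simp
  | insert a E ha ih =>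
    rw [sum_powerset_insert_sgn ha (fun z => ‖z‖ ^ q)]
    calc _ ≤ ∑ s ∈ E.powerset, (2 * ‖x + ∑ e ∈ E, sgn 𝕜 s e • y e‖ ^ q
            + 2 * K * ‖y a‖ ^ q) := Finset.sum_le_sum fun s _ => hX _ _
      _ = 2 * ∑ s ∈ E.powerset, ‖x + ∑ e ∈ E, sgn 𝕜 s e • y e‖ ^ q
            + 2 ^ E.card * (2 * K * ‖y a‖ ^ q) := by
          rw [Finset.sum_add_distrib, Finset.mul_sum]
          simp
      _ ≤ 2 * (2 ^ E.card * (‖x‖ ^ q + K * ∑ e ∈ E, ‖y e‖ ^ q))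
            + 2 ^ E.card * (2 * K * ‖y a‖ ^ q) := by gcongr
      _ = _ := by
          rw [Finset.card_insert_of_notMem ha, Finset.sum_insert ha]
          ring

/-- The average of `‖∑ ± y e‖` over all signs is at least the norm of each single term. -/
theorem le_sum_norm_signed {E : Finset ℕ} {e₀ : ℕ} (he : e₀ ∈ E) (y : ℕ → X) :
    2 ^ E.card * ‖y e₀‖ ≤ ∑ s ∈ E.powerset, ‖∑ e ∈ E, sgn 𝕜 s e • y e‖ := by
  induction E using Finset.induction_on with
  | empty => simp at he
  | insert a E ha ih =>
    have key := sum_powerset_insert_sgn (𝕜 := 𝕜) ha (fun z => ‖z‖) 0 y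
    simp only [zero_add] at key
    rw [key, Finset.card_insert_of_notMem ha, pow_succ]
    rcases Finset.mem_insert.1 he with rfl | he
    · calc (2 : ℝ) ^ E.card * 2 * ‖y e₀‖ = ∑ s ∈ E.powerset, 2 * ‖y e₀‖ := by simp; ring
        _ ≤ _ := Finset.sum_le_sum fun s _ => by
          have h := norm_sub_le (∑ e ∈ E, sgn 𝕜 s e • y e + y e₀)
            (∑ e ∈ E, sgn 𝕜 s e • y e - y e₀)
          have h2 : ∑ e ∈ E, sgn 𝕜 s e • y e + y e₀ - (∑ e ∈ E, sgn 𝕜 s e • y e - y e₀)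
            = (2 : 𝕜) • y e₀ := by rw [two_smul]; abel
          rw [h2, norm_smul] at h
          simpa using h
    · calc (2 : ℝ) ^ E.card * 2 * ‖y e₀‖ = 2 * (2 ^ E.card * ‖y e₀‖) := by ring
        _ ≤ 2 * ∑ s ∈ E.powerset, ‖∑ e ∈ E, sgn 𝕜 s e • y e‖ := by gcongr; exact ih he
        _ = ∑ s ∈ E.powerset, 2 * ‖∑ e ∈ E, sgn 𝕜 s e • y e‖ := by rw [Finset.mul_sum]
        _ ≤ _ := Finset.sum_le_sum fun s _ => by
          have h := norm_add_le (∑ e ∈ E, sgn 𝕜 s e • y e + y a)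
            (∑ e ∈ E, sgn 𝕜 s e • y e - y a)
          have h2 : ∑ e ∈ E, sgn 𝕜 s e • y e + y a + (∑ e ∈ E, sgn 𝕜 s e • y e - y a)
            = (2 : 𝕜) • ∑ e ∈ E, sgn 𝕜 s e • y e := by rw [two_smul]; abel
          rw [h2, norm_smul] at h
          simpa using h

/-- If the `ℓ₁` norm of the coefficients on `T` is controlled by `W` times the norm, then it is so
with additional `ℓ_q` summation over vectors whose coefficients are read off on disjoint subsets
`D e` of `T`: random signs keep the coefficients on the sets `D e`, while the norm of the signed
sum grows only like an `ℓ_q` sum. -/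
theorem sum_coeff_rpow_le {q K W : ℝ} (hX : PowerSmooth X q K) (hq : 1 ≤ q) (hW : 0 ≤ W)
    {ι : Type*} [DecidableEq ι] {g : ι → X} {T B : Finset ι}
    (hinc : ∀ c : ι → 𝕜, ∑ i ∈ T, ‖c i‖ ≤ W * ‖∑ i ∈ B, c i • g i‖)
    (E : Finset ℕ) (c : ℕ → ι → 𝕜) (D : ℕ → Finset ι) (hDT : ∀ e ∈ E, D e ⊆ T)
    (hD : (E : Set ℕ).PairwiseDisjoint D) :
    (∑ e ∈ E, ∑ i ∈ D e, ‖c e i‖) ^ q ≤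
      W ^ q * (K * ∑ e ∈ E, ‖∑ i ∈ B, c e i • g i‖ ^ q) := by
  have hcard : (0 : ℝ) < 2 ^ E.card := by positivity
  set Y : Finset ℕ → X := fun s => ∑ e ∈ E, sgn 𝕜 s e • ∑ i ∈ B, c e i • g i with hY
  have hYc : ∀ s, Y s = ∑ i ∈ B, (∑ e ∈ E, sgn 𝕜 s e • c e i) • g i := by
    intro s
    simp only [hY, Finset.smul_sum, Finset.sum_smul, smul_assoc]
    rw [Finset.sum_comm]
  have h1 : 2 ^ E.card * ∑ e ∈ E, ∑ i ∈ D e, ‖c e i‖ ≤ W * ∑ s ∈ E.powerset, ‖Y s‖ := by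
    calc 2 ^ E.card * ∑ e ∈ E, ∑ i ∈ D e, ‖c e i‖
        = ∑ e ∈ E, ∑ i ∈ D e, 2 ^ E.card * ‖c e i‖ := by simp only [Finset.mul_sum]
      _ ≤ ∑ e ∈ E, ∑ i ∈ D e, ∑ s ∈ E.powerset, ‖∑ e' ∈ E, sgn 𝕜 s e' • c e' i‖ := by
          refine Finset.sum_le_sum fun e he => Finset.sum_le_sum fun i _ => ?_
          exact le_sum_norm_signed (𝕜 := 𝕜) he (fun e' => c e' i)
      _ = ∑ i ∈ E.biUnion D, ∑ s ∈ E.powerset, ‖∑ e' ∈ E, sgn 𝕜 s e' • c e' i‖ := by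
          rw [Finset.sum_biUnion hD]
      _ ≤ ∑ i ∈ T, ∑ s ∈ E.powerset, ‖∑ e' ∈ E, sgn 𝕜 s e' • c e' i‖ := by
          refine Finset.sum_le_sum_of_subset_of_nonneg (Finset.biUnion_subset.2 hDT) ?_
          intros; positivity
      _ = ∑ s ∈ E.powerset, ∑ i ∈ T, ‖∑ e' ∈ E, sgn 𝕜 s e' • c e' i‖ := Finset.sum_comm
      _ ≤ ∑ s ∈ E.powerset, W * ‖Y s‖ := by
          refine Finset.sum_le_sum fun s _ => ?_
          rw [hYc]
          exact hinc _
      _ = _ := by rw [Finset.mul_sum]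
  have h2 : (∑ s ∈ E.powerset, ‖Y s‖) ^ q ≤
      (2 ^ E.card) ^ (q - 1) * ∑ s ∈ E.powerset, ‖Y s‖ ^ q := by
    have := Real.rpow_sum_le_const_mul_sum_rpow E.powerset (fun s => ‖Y s‖) hq
    simpa using this
  have h3 := sum_norm_signed_rpow_le (𝕜 := 𝕜) hX E 0 (fun e => ∑ i ∈ B, c e i • g i)
  simp only [zero_add, norm_zero, Real.zero_rpow (by linarith : q ≠ 0)] at h3
  have hnn : 0 ≤ ∑ e ∈ E, ∑ i ∈ D e, ‖c e i‖ := by positivity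
  have h4 : (2 ^ E.card : ℝ) ^ q * (∑ e ∈ E, ∑ i ∈ D e, ‖c e i‖) ^ q ≤
      (2 ^ E.card : ℝ) ^ q * (W ^ q * (K * ∑ e ∈ E, ‖∑ i ∈ B, c e i • g i‖ ^ q)) := by
    rw [← Real.mul_rpow hcard.le hnn]
    calc _ ≤ (W * ∑ s ∈ E.powerset, ‖Y s‖) ^ q :=
          Real.rpow_le_rpow (by positivity) h1 (by linarith)
      _ = W ^ q * (∑ s ∈ E.powerset, ‖Y s‖) ^ q :=
          Real.mul_rpow hW (by positivity)
      _ ≤ W ^ q * ((2 ^ E.card) ^ (q - 1) *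
            (2 ^ E.card * (K * ∑ e ∈ E, ‖∑ i ∈ B, c e i • g i‖ ^ q))) := by
          gcongr
          refine h2.trans ?_
          gcongr
      _ = _ := by
          have : (2 ^ E.card : ℝ) ^ q = (2 ^ E.card) ^ (q - 1) * 2 ^ E.card := by
            rw [Real.rpow_sub_one hcard.ne']
            field_simp
          rw [this]
          ring
  exact le_of_mul_le_mul_left h4 (by positivity)

end Signs

/-! ### Counting the steps by levels -/

/-- If `L` grows by at least `δ` right after each `k ∈ E` and is at least `a` there, then
`L m ≥ a + δ |E|` for every `m` beyond `E`. Nothing is required of `L` at `n` and later. -/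
theorem card_mul_le_of_increments {n : ℕ} {L : ℕ → ℝ} {a δ : ℝ}
    (hmono : ∀ k l, k ≤ l → l < n → L k ≤ L l) (E : Finset ℕ)
    (hE : ∀ k ∈ E, a ≤ L k ∧ (k + 1 < n → L k + δ ≤ L (k + 1))) (m : ℕ) (hm : m < n)
    (ham : a ≤ L m) (hEm : ∀ k ∈ E, k < m) :
    E.card * δ ≤ L m - a := by
  induction E using Finset.induction_on_max generalizing m with
  | empty => simpa using ham
  | insert b E hb ih =>
    have hbE : b ∉ E := fun h => lt_irrefl _ (hb b h)
    have hbm : b < m := hEm b (Finset.mem_insert_self _ _)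
    have h1 := ih (fun k hk => hE k (Finset.mem_insert_of_mem hk)) b (by omega)
      (hE b (Finset.mem_insert_self _ _)).1 hb
    have h2 := (hE b (Finset.mem_insert_self _ _)).2 (by omega)
    have h3 := hmono (b + 1) m hbm hm
    rw [Finset.card_insert_of_notMem hbE]
    push_cast
    linarith

/-- The counting argument. The steps `k < n` are grouped by their level `j k`. The quantity `L`
grows by `θ / z k` at step `k` and by at most `ℓ` within a level, so a level holds only
`O(max z)` steps; and the sum of the maxima is controlled for every other level. -/
theorem card_steps_le_of_levels {n : ℕ} {j : ℕ → ℤ} {L z : ℕ → ℝ} {θ ℓ b S : ℝ}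
    (hθ : 0 < θ) (hb : 0 < b) (hℓ : 0 ≤ ℓ)
    (hj : ∀ k l, k ≤ l → l < n → j l ≤ j k)
    (hz : ∀ k < n, b ≤ z k)
    (hL : ∀ k, k + 1 < n → L k + θ / z k ≤ L (k + 1))
    (hlev : ∀ k < n, ∀ l < n, j k = j l → L l - L k ≤ ℓ)
    (hS : ∀ E : Finset ℕ, (∀ k ∈ E, k < n) →
      (∀ k ∈ E, ∀ l ∈ E, k < l → j l + 2 ≤ j k) → ∑ k ∈ E, z k ≤ S) :
    (n : ℝ) ≤ 2 * (1 / b + ℓ / θ) * S := by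
  classical
  have hmono : ∀ k l, k ≤ l → l < n → L k ≤ L l := by
    intro k l hkl
    induction l, hkl using Nat.le_induction with
    | base => intro _; exact le_rfl
    | succ l hkl ih =>
      intro hl
      have h1 := ih (by omega)
      have h2 := hL l hl
      have h3 : 0 < θ / z l := div_pos hθ (hb.trans_le (hz l (by omega)))
      linarith
  set I := (Finset.range n).image j with hI
  set P : ℤ → Finset ℕ := fun i => (Finset.range n).filter (fun k => j k = i) with hP
  have hPne : ∀ i ∈ I, (P i).Nonempty := by
    intro i hi
    obtain ⟨k, hk, rfl⟩ := Finset.mem_image.1 hi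
    exact ⟨k, Finset.mem_filter.2 ⟨hk, rfl⟩⟩
  -- `κ i` is a step of level `i` at which `z` is maximal
  have hex : ∀ i, ∃ k, i ∈ I → (k ∈ P i ∧ ∀ l ∈ P i, z l ≤ z k) := by
    intro i
    by_cases hi : i ∈ I
    · obtain ⟨k, hk, hmax⟩ := Finset.exists_max_image (P i) z (hPne i hi)
      exact ⟨k, fun _ => ⟨hk, hmax⟩⟩
    · exact ⟨0, fun h => absurd h hi⟩
  choose κ hκ using hex
  have hκn : ∀ i ∈ I, κ i < n ∧ j (κ i) = i := by
    intro i hi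
    have := Finset.mem_filter.1 (hκ i hi).1
    exact ⟨Finset.mem_range.1 this.1, this.2⟩
  have hfib : ∀ i ∈ I, ((P i).card : ℝ) ≤ (1 / b + ℓ / θ) * z (κ i) := by
    intro i hi
    have hzκ : b ≤ z (κ i) := hz _ (hκn i hi).1
    have hzpos : 0 < z (κ i) := hb.trans_le hzκ
    set M := (P i).max' (hPne i hi)
    have hMP : M ∈ P i := (P i).max'_mem _
    have hMn : M < n := Finset.mem_range.1 (Finset.mem_filter.1 hMP).1
    set m₀ := (P i).min' (hPne i hi)
    have hm₀P : m₀ ∈ P i := (P i).min'_mem _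
    have hm₀n : m₀ < n := Finset.mem_range.1 (Finset.mem_filter.1 hm₀P).1
    have hlow : ∀ k ∈ P i, L m₀ ≤ L k := fun k hk =>
      hmono _ _ ((P i).min'_le k hk) (Finset.mem_range.1 (Finset.mem_filter.1 hk).1)
    -- the last step of a level is left out, because `L` may leave its range there
    have h1 := card_mul_le_of_increments (a := L m₀) (δ := θ / z (κ i)) hmono ((P i).erase M)
      (by
        intro k hk
        have hkP := Finset.mem_of_mem_erase hk
        refine ⟨hlow k hkP, fun hkn => le_trans ?_ (hL k hkn)⟩
        have hzk : 0 < z k := hb.trans_le (hz k (by omega))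
        have := (hκ i hi).2 k hkP
        gcongr) M hMn (hlow M hMP)
      (fun k hk => lt_of_le_of_ne ((P i).le_max' k (Finset.mem_of_mem_erase hk))
        (Finset.ne_of_mem_erase hk))
    have h2 : L M - L m₀ ≤ ℓ := hlev _ hm₀n _ hMn
      ((Finset.mem_filter.1 hm₀P).2.trans (Finset.mem_filter.1 hMP).2.symm)
    have h3 : (((P i).erase M).card : ℝ) = (P i).card - 1 := by
      rw [Finset.card_erase_of_mem hMP, Nat.cast_sub (Finset.card_pos.2 (hPne i hi))]
      simp
    rw [h3] at h1
    have h4 : ((P i).card - 1 : ℝ) ≤ ℓ / θ * z (κ i) := by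
      have h5 := h1.trans h2
      rw [← mul_div_assoc, div_le_iff₀ hzpos] at h5
      rw [div_mul_eq_mul_div, le_div_iff₀ hθ]
      exact h5
    have h5 : 1 ≤ 1 / b * z (κ i) := by
      rw [one_div_mul_eq_div, le_div_iff₀ hb]; linarith
    linarith
  have hhalf : ∀ J ⊆ I, (∀ i ∈ J, ∀ i' ∈ J, i' < i → i' + 2 ≤ i) → ∑ i ∈ J, z (κ i) ≤ S := by
    intro J hJ hgap
    have hinj : Set.InjOn κ J := by
      intro i hi i' hi' h
      rw [← (hκn i (hJ hi)).2, ← (hκn i' (hJ hi')).2, h]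
    rw [← Finset.sum_image hinj (f := z)]
    refine hS _ ?_ ?_
    · intro k hk
      obtain ⟨i, hi, rfl⟩ := Finset.mem_image.1 hk
      exact (hκn i (hJ hi)).1
    · intro k hk l hl hkl
      obtain ⟨i, hi, rfl⟩ := Finset.mem_image.1 hk
      obtain ⟨i', hi', rfl⟩ := Finset.mem_image.1 hl
      have h1 := hj _ _ hkl.le (hκn i' (hJ hi')).1
      rw [(hκn i (hJ hi)).2, (hκn i' (hJ hi')).2] at h1 ⊢
      refine hgap i hi i' hi' (lt_of_le_of_ne h1 ?_)
      rintro rfl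
      exact lt_irrefl _ hkl
  have hsum : (n : ℝ) = ∑ i ∈ I, ((P i).card : ℝ) := by
    have := Finset.card_eq_sum_card_image j (Finset.range n)
    rw [Finset.card_range] at this
    exact_mod_cast this
  have hev := hhalf (I.filter (fun i => Even i)) (Finset.filter_subset _ _) (by
    intro i hi i' hi' h
    obtain ⟨x, hx⟩ := (Finset.mem_filter.1 hi).2
    obtain ⟨y, hy⟩ := (Finset.mem_filter.1 hi').2
    omega)
  have hod := hhalf (I.filter (fun i => ¬ Even i)) (Finset.filter_subset _ _) (by
    intro i hi i' hi' h
    obtain ⟨x, hx⟩ := Int.not_even_iff_odd.1 (Finset.mem_filter.1 hi).2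
    obtain ⟨y, hy⟩ := Int.not_even_iff_odd.1 (Finset.mem_filter.1 hi').2
    omega)
  have hpos : 0 ≤ 1 / b + ℓ / θ := by positivity
  calc (n : ℝ) = ∑ i ∈ I, ((P i).card : ℝ) := hsum
    _ ≤ ∑ i ∈ I, (1 / b + ℓ / θ) * z (κ i) := Finset.sum_le_sum hfib
    _ = (1 / b + ℓ / θ) * (∑ i ∈ I.filter (fun i => Even i), z (κ i)
          + ∑ i ∈ I.filter (fun i => ¬ Even i), z (κ i)) := by
        rw [← Finset.mul_sum, Finset.sum_filter_add_sum_filter_not]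
    _ ≤ (1 / b + ℓ / θ) * (S + S) := by gcongr
    _ = _ := by ring

/-! ### One step of the greedy algorithm -/

section Greedy

variable {𝕜 : Type*} [RCLike 𝕜] {X : Type*} [NormedAddCommGroup X] [NormedSpace 𝕜 X]

/-- The power function lies above its tangents. -/
theorem rpow_add_mul_sub_le_rpow {q a b : ℝ} (hq : 1 ≤ q) (ha : 0 < a) (hb : 0 ≤ b) :
    a ^ q + q * a ^ (q - 1) * (b - a) ≤ b ^ q := by
  have h := one_add_mul_self_le_rpow_one_add (s := b / a - 1) (by
    have : 0 ≤ b / a := by positivity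
    linarith) hq
  have h2 : (1 : ℝ) + (b / a - 1) = b / a := by ring
  rw [h2, Real.div_rpow hb ha.le, le_div_iff₀ (by positivity)] at h
  have h3 : a ^ (q - 1) = a ^ q / a := Real.rpow_sub_one ha.ne' q
  rw [h3]
  calc _ = (1 + q * (b / a - 1)) * a ^ q := by field_simp
    _ ≤ _ := h

/-- First-order expansion of the norm along a norming functional, with a remainder of order `q`:
`‖x + y‖` is at least `‖x‖ + re (F y)`, so smoothness bounds `‖x - y‖` from above. -/
theorem norm_sub_rpow_le {q K : ℝ} (hX : PowerSmooth X q K) (hq : 1 ≤ q) {x : X} (hx : x ≠ 0)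
    {F : StrongDual 𝕜 X} (hF : ‖F‖ = 1) (hFx : F x = ((‖x‖ : ℝ) : 𝕜)) (y : X) :
    ‖x - y‖ ^ q ≤ ‖x‖ ^ q - q * ‖x‖ ^ (q - 1) * RCLike.re (F y) + 2 * K * ‖y‖ ^ q := by
  have h1 : ‖x‖ + RCLike.re (F y) ≤ ‖x + y‖ := by
    calc ‖x‖ + RCLike.re (F y) = RCLike.re (F (x + y)) := by rw [map_add, hFx]; simp
      _ ≤ ‖F (x + y)‖ := RCLike.re_le_norm _
      _ ≤ ‖F‖ * ‖x + y‖ := F.le_opNorm _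
      _ = ‖x + y‖ := by rw [hF, one_mul]
  have h2 := rpow_add_mul_sub_le_rpow hq (norm_pos_iff.2 hx) (norm_nonneg (x + y))
  have h3 := hX x y
  have h4 : q * ‖x‖ ^ (q - 1) * RCLike.re (F y) ≤ q * ‖x‖ ^ (q - 1) * (‖x + y‖ - ‖x‖) := by
    gcongr; linarith
  linarith

/-- In a smooth space, a norming functional of the error of best approximation from a subspace
annihilates the subspace. -/
theorem apply_eq_zero_of_best {q K : ℝ} (hX : PowerSmooth X q K) (hq : 1 < q) (hK : 0 < K)
    {x : X} (hx : x ≠ 0) {F : StrongDual 𝕜 X} (hF : ‖F‖ = 1)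
    (hFx : F x = ((‖x‖ : ℝ) : 𝕜)) {M : Submodule 𝕜 X} (hM : ∀ h ∈ M, ‖x‖ ≤ ‖x - h‖) {y : X}
    (hy : y ∈ M) : F y = 0 := by
  by_contra hne
  have hxpos := norm_pos_iff.2 hx
  set z : X := (F y)⁻¹ • y with hz
  have hFz : F z = 1 := by simp [hz, hne]
  set D : ℝ := q * ‖x‖ ^ (q - 1) with hD
  have hDpos : 0 < D := by positivity
  set Q : ℝ := 2 * K * ‖z‖ ^ q with hQ
  have hQ0 : 0 ≤ Q := by positivity
  -- moving by `s • z` gains `D s` to first order and loses only `Q s ^ q`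
  have key : ∀ s : ℝ, 0 < s → D ≤ Q * s ^ (q - 1) := by
    intro s hs
    have h1 := hM ((s : 𝕜) • z) (M.smul_mem _ (M.smul_mem _ hy))
    have h2 := norm_sub_rpow_le hX hq.le hx hF hFx ((s : 𝕜) • z)
    have h3 : ‖x‖ ^ q ≤ ‖x - (s : 𝕜) • z‖ ^ q :=
      Real.rpow_le_rpow (norm_nonneg _) h1 (by linarith)
    have h4 : RCLike.re (F ((s : 𝕜) • z)) = s := by simp [hFz]
    have h5 : ‖(s : 𝕜) • z‖ ^ q = s ^ q * ‖z‖ ^ q := by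
      rw [norm_smul, Real.mul_rpow (norm_nonneg _) (norm_nonneg _), RCLike.norm_ofReal,
        abs_of_pos hs]
    rw [h4, h5] at h2
    have h6 : s ^ q = s ^ (q - 1) * s := by
      rw [Real.rpow_sub_one hs.ne']; field_simp
    rw [h6] at h2
    have h7 : D * s ≤ Q * s ^ (q - 1) * s := by
      rw [hD, hQ]; nlinarith
    exact le_of_mul_le_mul_right h7 hs
  set s : ℝ := (D / (2 * (Q + 1))) ^ (1 / (q - 1)) with hs
  have hspos : 0 < s := by positivity
  have hsq : s ^ (q - 1) = D / (2 * (Q + 1)) := by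
    rw [hs, ← Real.rpow_mul (by positivity), one_div_mul_cancel (by linarith), Real.rpow_one]
  have h := key s hspos
  rw [hsq, ← mul_div_assoc, le_div_iff₀ (by positivity)] at h
  nlinarith

/-- The factor in the relative decrease `gain q K * δ ^ q'` of `‖x‖ ^ q` that one step along an
element of norm at most `2` achieves when the norming functional of `x` has size `δ` on it. -/
noncomputable def gain (q K : ℝ) : ℝ := (16 * K) ^ (-(1 / (q - 1))) / 2

theorem gain_pos {q K : ℝ} (hK : 0 < K) : 0 < gain q K := by unfold gain; positivity

/-- A suitable multiple of an element `g` on which the norming functional of `x` is large reduces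
the norm of `x`. -/
theorem exists_norm_sub_smul_rpow_le {q K : ℝ} (hX : PowerSmooth X q K) (hq : 1 < q) (hq2 : q ≤ 2)
    (hK : 0 < K) {x : X} (hx : x ≠ 0) {F : StrongDual 𝕜 X} (hF : ‖F‖ = 1)
    (hFx : F x = ((‖x‖ : ℝ) : 𝕜)) {g : X} (hg : ‖g‖ ≤ 2) (hFg : F g ≠ 0) :
    ∃ c : 𝕜, ‖x - c • g‖ ^ q ≤ ‖x‖ ^ q * (1 - gain q K * ‖F g‖ ^ (q / (q - 1))) := by
  have hxpos := norm_pos_iff.2 hx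
  have hq1 : 0 < q - 1 := by linarith
  set δ := ‖F g‖ with hδ
  have hδpos : 0 < δ := norm_pos_iff.2 hFg
  set κ : ℝ := (16 * K) ^ (-(1 / (q - 1))) with hκ
  have hκpos : 0 < κ := by positivity
  have hκq : κ ^ (q - 1) = (16 * K)⁻¹ := by
    rw [hκ, ← Real.rpow_mul (by positivity), neg_mul, one_div_mul_cancel hq1.ne', Real.rpow_neg_one]
  -- `lam` balances the first-order gain `q * lam * δ` against the loss `8 * K * lam ^ q`
  set lam : ℝ := κ * δ ^ (1 / (q - 1)) with hlam
  have hlampos : 0 < lam := by positivity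
  have hlamq : lam ^ (q - 1) = (16 * K)⁻¹ * δ := by
    rw [hlam, Real.mul_rpow hκpos.le (by positivity), hκq, ← Real.rpow_mul hδpos.le,
      one_div_mul_cancel hq1.ne', Real.rpow_one]
  have hlamδ : lam * δ = κ * δ ^ (q / (q - 1)) := by
    rw [hlam, mul_assoc, ← Real.rpow_add_one hδpos.ne']
    congr 2
    field_simp
    ring
  set c : 𝕜 := ((‖x‖ * lam * δ : ℝ) : 𝕜) * (F g)⁻¹ with hc
  have hFc : F (c • g) = ((‖x‖ * lam * δ : ℝ) : 𝕜) := by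
    rw [map_smul, smul_eq_mul, hc, mul_assoc, inv_mul_cancel₀ hFg, mul_one]
  have hcn : ‖c‖ = ‖x‖ * lam := by
    rw [hc, norm_mul, norm_inv, RCLike.norm_ofReal, abs_of_pos (by positivity), ← hδ]
    field_simp
  refine ⟨c, (norm_sub_rpow_le hX hq.le hx hF hFx (c • g)).trans ?_⟩
  rw [hFc, RCLike.ofReal_re]
  have h1 : ‖c • g‖ ^ q ≤ ‖x‖ ^ q * (4 * lam ^ q) := by
    calc ‖c • g‖ ^ q ≤ (‖x‖ * lam * 2) ^ q := by
          rw [norm_smul, hcn]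
          exact Real.rpow_le_rpow (by positivity) (by gcongr) (by linarith)
      _ = ‖x‖ ^ q * (2 ^ q * lam ^ q) := by
          rw [Real.mul_rpow (by positivity) (by norm_num), Real.mul_rpow hxpos.le hlampos.le]
          ring
      _ ≤ ‖x‖ ^ q * (4 * lam ^ q) := by
          gcongr
          calc (2 : ℝ) ^ q ≤ 2 ^ (2 : ℝ) := Real.rpow_le_rpow_of_exponent_le (by norm_num) hq2
            _ = 4 := by norm_num
  have h2 : lam ^ q = (16 * K)⁻¹ * δ * lam := by
    rw [← hlamq, Real.rpow_sub_one hlampos.ne']; field_simp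
  have h3 : ‖x‖ ^ (q - 1) * ‖x‖ = ‖x‖ ^ q := by
    rw [Real.rpow_sub_one hxpos.ne']; field_simp
  have h4 : gain q K * δ ^ (q / (q - 1)) = lam * δ / 2 := by
    rw [hlamδ, gain, ← hκ]; ring
  rw [h4]
  have h5 : 2 * K * ‖c • g‖ ^ q ≤ ‖x‖ ^ q * (lam * δ / 2) := by
    calc 2 * K * ‖c • g‖ ^ q ≤ 2 * K * (‖x‖ ^ q * (4 * lam ^ q)) := by gcongr
      _ = _ := by rw [h2]; field_simp; ring
  have h6 : q * ‖x‖ ^ (q - 1) * (‖x‖ * lam * δ) = q * (‖x‖ ^ q * (lam * δ)) := by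
    rw [← h3]; ring
  rw [h6]
  have h7 : 1 * (‖x‖ ^ q * (lam * δ)) ≤ q * (‖x‖ ^ q * (lam * δ)) := by gcongr
  linarith

end Greedy

/-! ### Lebesgue-type inequality for the greedy algorithm -/

section Lebesgue

variable {𝕜 : Type*} [RCLike 𝕜] {X : Type*} [NormedAddCommGroup X] [NormedSpace 𝕜 X]
  {ι : Type*}

theorem mem_chosenSpan_of_lt {E : Type*} [AddCommGroup E] [Module 𝕜 E] (g : ι → E) {φ : ℕ → ι}
    {j k : ℕ} (hjk : j < k) : g (φ j) ∈ chosenSpan 𝕜 g φ k :=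
  Submodule.subset_span ⟨j, hjk, rfl⟩

theorem chosenSpan_mono {E : Type*} [AddCommGroup E] [Module 𝕜 E] (g : ι → E) (φ : ℕ → ι)
    {k l : ℕ} (h : k ≤ l) : chosenSpan 𝕜 g φ k ≤ chosenSpan 𝕜 g φ l :=
  Submodule.span_mono (Set.image_mono fun _ hj => lt_of_lt_of_le hj h)

variable {g : ι → X} {f₀ : X} {φ : ℕ → ι} {G : ℕ → X} {t : ℝ}

theorem IsWCGA.residual_anti (hG : IsWCGA (𝕜 := 𝕜) t g f₀ φ G) {k l : ℕ} (h : k ≤ l) :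
    ‖f₀ - G l‖ ≤ ‖f₀ - G k‖ :=
  hG.best l _ (chosenSpan_mono g φ h (hG.mem k))

variable [DecidableEq ι]

/-- The elements of `T` that are not selected in the first `k` steps. -/
def unselected (T : Finset ι) (φ : ℕ → ι) (k : ℕ) : Finset ι :=
  T \ (Finset.range k).image φ

/-- The `ℓ₁` norm of the coefficients of the unselected elements. -/
def unselectedMass (x : ι → 𝕜) (T : Finset ι) (φ : ℕ → ι) (k : ℕ) : ℝ :=
  ∑ i ∈ unselected T φ k, ‖x i‖

theorem unselected_anti (T : Finset ι) (φ : ℕ → ι) {k l : ℕ} (h : k ≤ l) :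
    unselected T φ l ⊆ unselected T φ k := by
  unfold unselected
  gcongr

theorem unselectedMass_anti (x : ι → 𝕜) (T : Finset ι) (φ : ℕ → ι) {k l : ℕ} (h : k ≤ l) :
    unselectedMass x T φ l ≤ unselectedMass x T φ k :=
  Finset.sum_le_sum_of_subset_of_nonneg (unselected_anti T φ h) fun _ _ _ => norm_nonneg _

theorem mem_chosenSpan_iff {E : Type*} [AddCommGroup E] [Module 𝕜 E] {g : ι → E} {φ : ℕ → ι}
    {k : ℕ} {h : E} :
    h ∈ chosenSpan 𝕜 g φ k ↔ ∃ d : ι → 𝕜, ∑ i ∈ (Finset.range k).image φ, d i • g i = h := by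
  rw [← Submodule.mem_span_image_finset_iff_exists_fun', chosenSpan]
  have : (fun j => g (φ j)) '' {j | j < k} = g '' ((Finset.range k).image φ : Finset ι) := by
    ext; simp
  rw [this]

theorem sum_selected_mem_chosenSpan {E : Type*} [AddCommGroup E] [Module 𝕜 E] (g : ι → E)
    (x : ι → 𝕜) (T : Finset ι) (φ : ℕ → ι) (k : ℕ) :
    ∑ i ∈ T, x i • g i - ∑ i ∈ unselected T φ k, x i • g i ∈ chosenSpan 𝕜 g φ k := by
  have hsub : unselected T φ k ⊆ T := Finset.sdiff_subset
  rw [← Finset.sum_sdiff hsub, add_sub_cancel_right]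
  refine Submodule.sum_mem _ fun i hi => Submodule.smul_mem _ _ ?_
  simp only [unselected, Finset.mem_sdiff, not_and, not_not] at hi
  obtain ⟨l, hl, rfl⟩ := Finset.mem_image.1 (hi.2 hi.1)
  exact mem_chosenSpan_of_lt g (Finset.mem_range.1 hl)

/-- The difference of a sparse element and an element of the span of the chosen ones keeps the
coefficients of the former at the unselected indices. -/
theorem exists_coeff_sub_of_mem_chosenSpan {E : Type*} [AddCommGroup E] [Module 𝕜 E] {g : ι → E}
    {φ : ℕ → ι} {k n : ℕ} (hk : k ≤ n) {h : E} (hh : h ∈ chosenSpan 𝕜 g φ k) (x : ι → 𝕜)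
    (T : Finset ι) :
    ∃ c : ι → 𝕜, (∀ i ∈ unselected T φ k, c i = x i) ∧
      ∑ i ∈ T ∪ (Finset.range n).image φ, c i • g i = ∑ i ∈ T, x i • g i - h := by
  obtain ⟨d, rfl⟩ := mem_chosenSpan_iff.1 hh
  refine ⟨fun i => (if i ∈ T then x i else 0) -
    (if i ∈ (Finset.range k).image φ then d i else 0), ?_, ?_⟩
  · intro i hi
    have hi := Finset.mem_sdiff.1 hi
    simp only [hi.1, hi.2, if_true, if_false, sub_zero]
  · have hsub : (Finset.range k).image φ ⊆ (Finset.range n).image φ := by gcongr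
    simp only [sub_smul, Finset.sum_sub_distrib, ite_smul, zero_smul]
    rw [← Finset.sum_filter, ← Finset.sum_filter, Finset.filter_mem_eq_inter,
      Finset.filter_mem_eq_inter, Finset.inter_eq_right.2 Finset.subset_union_left,
      Finset.inter_eq_right.2 (hsub.trans Finset.subset_union_right)]

/-- The residual is controlled by the unselected mass, because the selected part of the sparse
approximant is a competitor for `G k`. -/
theorem IsWCGA.residual_le (hG : IsWCGA (𝕜 := 𝕜) t g f₀ φ G) (hg : ∀ i, ‖g i‖ ≤ 2)
    (T : Finset ι) (x : ι → 𝕜) (k : ℕ) :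
    ‖f₀ - G k‖ ≤ ‖f₀ - ∑ i ∈ T, x i • g i‖ + 2 * unselectedMass x T φ k := by
  calc ‖f₀ - G k‖
      ≤ ‖f₀ - (∑ i ∈ T, x i • g i - ∑ i ∈ unselected T φ k, x i • g i)‖ :=
        hG.best k _ (sum_selected_mem_chosenSpan g x T φ k)
    _ = ‖(f₀ - ∑ i ∈ T, x i • g i) + ∑ i ∈ unselected T φ k, x i • g i‖ := by
        congr 1; abel
    _ ≤ ‖f₀ - ∑ i ∈ T, x i • g i‖ + ∑ i ∈ unselected T φ k, ‖x i • g i‖ :=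
        (norm_add_le _ _).trans (by gcongr; exact norm_sum_le _ _)
    _ ≤ _ := by
        rw [unselectedMass, Finset.mul_sum]
        gcongr with i _
        rw [norm_smul, mul_comm]
        gcongr
        exact hg i

/-- The size of a norming functional of the residual on the chosen element. -/
theorem IsWCGA.exists_functional (hG : IsWCGA (𝕜 := 𝕜) t g f₀ φ G) {q K : ℝ}
    (hX : PowerSmooth X q K) (hq : 1 < q) (hK : 0 < K) (ht : 0 < t) (T : Finset ι) (x : ι → 𝕜)
    {k : ℕ} (hρ : 4 * ‖f₀ - ∑ i ∈ T, x i • g i‖ < ‖f₀ - G k‖) :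
    ∃ F : StrongDual 𝕜 X, ‖F‖ = 1 ∧ F (f₀ - G k) = ((‖f₀ - G k‖ : ℝ) : 𝕜) ∧
      t * ‖f₀ - G k‖ ≤ 2 * unselectedMass x T φ k * ‖F (g (φ k))‖ := by
  set f := ∑ i ∈ T, x i • g i with hf
  have hρpos : 0 < ‖f₀ - G k‖ := lt_of_le_of_lt (by positivity) hρ
  have hne : f₀ - G k ≠ 0 := norm_pos_iff.1 hρpos
  obtain ⟨F, hF, hFx, hgr⟩ := hG.greedy k hne
  refine ⟨F, hF, hFx, ?_⟩
  have hkill : ∀ y ∈ chosenSpan 𝕜 g φ k, F y = 0 := fun y hy =>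
    apply_eq_zero_of_best hX hq hK hne hF hFx (fun h hh => by
      rw [sub_sub]
      exact hG.best k _ (Submodule.add_mem _ (hG.mem k) hh)) hy
  have h1 : F (∑ i ∈ unselected T φ k, x i • g i) = F (f₀ - G k) - F (f₀ - f) := by
    have h2 := hkill _ (sum_selected_mem_chosenSpan g x T φ k)
    have h3 := hkill _ (hG.mem k)
    rw [map_sub, ← hf, sub_eq_zero] at h2
    rw [map_sub, map_sub, h3, ← h2]
    ring
  have h2 : ‖F (f₀ - f)‖ ≤ ‖f₀ - f‖ := by
    simpa [hF] using F.le_opNorm (f₀ - f)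
  have h3 : ‖f₀ - G k‖ - ‖f₀ - f‖ ≤ ‖F (∑ i ∈ unselected T φ k, x i • g i)‖ := by
    rw [h1]
    have h4 := norm_sub_norm_le (F (f₀ - G k)) (F (f₀ - f))
    rw [hFx, RCLike.norm_ofReal, abs_of_pos hρpos] at h4
    rw [hFx]
    linarith
  have h4 : t * ‖F (∑ i ∈ unselected T φ k, x i • g i)‖ ≤
      unselectedMass x T φ k * ‖F (g (φ k))‖ := by
    calc _ ≤ t * ∑ i ∈ unselected T φ k, ‖x i‖ * ‖F (g i)‖ := by
          gcongr
          rw [map_sum]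
          refine (norm_sum_le _ _).trans (le_of_eq ?_)
          simp [norm_mul]
      _ = ∑ i ∈ unselected T φ k, ‖x i‖ * (t * ‖F (g i)‖) := by
          rw [Finset.mul_sum]
          exact Finset.sum_congr rfl fun i _ => by ring
      _ ≤ ∑ i ∈ unselected T φ k, ‖x i‖ * ‖F (g (φ k))‖ := by
          gcongr with i _
          exact hgr i
      _ = _ := by rw [unselectedMass, Finset.sum_mul]
  have h5 : ‖f₀ - G k‖ ≤ 2 * ‖F (∑ i ∈ unselected T φ k, x i • g i)‖ := by
    linarith [norm_nonneg (f₀ - f)]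
  calc t * ‖f₀ - G k‖ ≤ t * (2 * ‖F (∑ i ∈ unselected T φ k, x i • g i)‖) := by gcongr
    _ ≤ _ := by linarith

/-- The decrease of the residual in one step, in logarithmic form. -/
theorem IsWCGA.log_residual_succ_le (hG : IsWCGA (𝕜 := 𝕜) t g f₀ φ G) {q K : ℝ}
    (hX : PowerSmooth X q K) (hq : 1 < q) (hq2 : q ≤ 2) (hK : 0 < K) (ht : 0 < t)
    (hg : ∀ i, ‖g i‖ ≤ 2) (T : Finset ι) (x : ι → 𝕜) {k : ℕ}
    (hρ : 4 * ‖f₀ - ∑ i ∈ T, x i • g i‖ < ‖f₀ - G k‖) (hpos : 0 < ‖f₀ - G (k + 1)‖)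
    (hM : 0 < unselectedMass x T φ k) :
    Real.log ‖f₀ - G (k + 1)‖ + gain q K * (t / 2) ^ (q / (q - 1)) / q /
      (unselectedMass x T φ k / ‖f₀ - G k‖) ^ (q / (q - 1)) ≤ Real.log ‖f₀ - G k‖ := by
  have hρpos : 0 < ‖f₀ - G k‖ := lt_of_le_of_lt (by positivity) hρ
  have hq1 : 0 < q - 1 := by linarith
  obtain ⟨F, hF, hFx, hδ⟩ := hG.exists_functional hX hq hK ht T x hρ
  set M := unselectedMass x T φ k
  set ρ := ‖f₀ - G k‖
  have hδ' : t / 2 / (M / ρ) ≤ ‖F (g (φ k))‖ := by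
    rw [div_le_iff₀ (by positivity), ← mul_div_assoc, le_div_iff₀ hρpos]
    linarith
  have hFg : F (g (φ k)) ≠ 0 := by
    rw [← norm_pos_iff]
    exact lt_of_lt_of_le (by positivity) hδ'
  obtain ⟨c, hc⟩ := exists_norm_sub_smul_rpow_le hX hq hq2 hK (norm_pos_iff.1 hρpos) hF hFx
    (hg (φ k)) hFg
  have hbest : ‖f₀ - G (k + 1)‖ ≤ ‖f₀ - G k - c • g (φ k)‖ := by
    rw [sub_sub]
    exact hG.best (k + 1) _ (Submodule.add_mem _ (chosenSpan_mono g φ k.le_succ (hG.mem k))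
      (Submodule.smul_mem _ _ (mem_chosenSpan_of_lt g k.lt_succ_self)))
  have h1 : ‖f₀ - G (k + 1)‖ ^ q ≤
      ρ ^ q * (1 - gain q K * ‖F (g (φ k))‖ ^ (q / (q - 1))) :=
    (Real.rpow_le_rpow hpos.le hbest (by linarith)).trans hc
  set u := gain q K * ‖F (g (φ k))‖ ^ (q / (q - 1)) with hu
  have hpq : 0 < ‖f₀ - G (k + 1)‖ ^ q := by positivity
  have hu1 : 0 < 1 - u := by
    have := hpq.trans_le h1
    exact (pos_iff_pos_of_mul_pos this).1 (by positivity)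
  have h2 : q * Real.log ‖f₀ - G (k + 1)‖ ≤ q * Real.log ρ + Real.log (1 - u) := by
    rw [← Real.log_rpow hpos, ← Real.log_rpow hρpos, ← Real.log_mul (by positivity) hu1.ne']
    exact Real.log_le_log hpq h1
  have h3 := Real.log_le_sub_one_of_pos hu1
  have h4 : gain q K * ((t / 2) ^ (q / (q - 1)) / (M / ρ) ^ (q / (q - 1))) ≤ u := by
    rw [hu, ← Real.div_rpow (by positivity) (by positivity)]
    have := gain_pos (q := q) hK
    gcongr
  have h5 : gain q K * (t / 2) ^ (q / (q - 1)) / q / (M / ρ) ^ (q / (q - 1)) =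
      gain q K * ((t / 2) ^ (q / (q - 1)) / (M / ρ) ^ (q / (q - 1))) / q := by ring
  rw [h5]
  have hq0 : 0 < q := by linarith
  have h6 : gain q K * ((t / 2) ^ (q / (q - 1)) / (M / ρ) ^ (q / (q - 1))) / q ≤ u / q := by
    gcongr
  have h7 : Real.log ‖f₀ - G (k + 1)‖ + u / q ≤ Real.log ρ := by
    refine le_of_mul_le_mul_left ?_ hq0
    rw [mul_add, mul_div_cancel₀ _ hq0.ne']
    linarith
  linarith

/-- If the unselected mass at least halves between any two steps of `E`, then the ratios of
unselected mass and residual at the steps of `E` are `ℓ_{q'}` summable: the vectors `f - G k`,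
`k ∈ E`, have large coefficients on disjoint sets of indices. -/
theorem IsWCGA.sum_ratio_rpow_le (hG : IsWCGA (𝕜 := 𝕜) t g f₀ φ G) {q K W : ℝ}
    (hX : PowerSmooth X q K) (hq : 1 < q) (hK : 0 < K) (hW : 0 < W) (T : Finset ι)
    (x : ι → 𝕜) {n : ℕ}
    (hinc : ∀ c : ι → 𝕜, ∑ i ∈ T, ‖c i‖ ≤
      W * ‖∑ i ∈ T ∪ (Finset.range n).image φ, c i • g i‖)
    (hρ : ∀ k < n, 4 * ‖f₀ - ∑ i ∈ T, x i • g i‖ < ‖f₀ - G k‖)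
    (E : Finset ℕ) (hE : ∀ k ∈ E, k < n)
    (hEM : ∀ k ∈ E, ∀ l ∈ E, k < l → unselectedMass x T φ l ≤ unselectedMass x T φ k / 2) :
    ∑ k ∈ E, (unselectedMass x T φ k / ‖f₀ - G k‖) ^ (q / (q - 1)) ≤
      (4 ^ q * K * W ^ q) ^ (1 / (q - 1)) := by
  have hq1 : 0 < q - 1 := by linarith
  set q' := q / (q - 1) with hq'
  have hq'1 : (q' - 1) * q = q' := by rw [hq']; field_simp; ring
  set f := ∑ i ∈ T, x i • g i with hf
  set M := unselectedMass x T φ with hM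
  have hρpos : ∀ k < n, 0 < ‖f₀ - G k‖ := fun k hk => lt_of_le_of_lt (by positivity) (hρ k hk)
  have hM0 : ∀ k, 0 ≤ M k := fun k => Finset.sum_nonneg fun _ _ => norm_nonneg _
  have hex : ∀ k, ∃ c : ι → 𝕜, k ≤ n → (∀ i ∈ unselected T φ k, c i = x i) ∧
      ∑ i ∈ T ∪ (Finset.range n).image φ, c i • g i = f - G k := by
    intro k
    by_cases hk : k ≤ n
    · obtain ⟨c, hc⟩ := exists_coeff_sub_of_mem_chosenSpan hk (hG.mem k) x T
      exact ⟨c, fun _ => hc⟩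
    · exact ⟨0, fun h => absurd h hk⟩
  choose c hc using hex
  set s : ℕ → ℝ := fun k => M k / ‖f₀ - G k‖ with hs
  have hs0 : ∀ k, 0 ≤ s k := fun k => div_nonneg (hM0 k) (norm_nonneg _)
  -- weights for which the `q`-th power of the norm of `a k • (f - G k)` and the sum of its
  -- coefficients over `D k` are both comparable to `s k ^ q'`
  set a : ℕ → ℝ := fun k => s k ^ (q' - 1) / ‖f₀ - G k‖ with ha
  have ha0 : ∀ k, 0 ≤ a k := fun k =>
    div_nonneg (Real.rpow_nonneg (hs0 k) _) (norm_nonneg _)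
  set D : ℕ → Finset ι := fun k =>
    (unselected T φ k).filter (fun i => ∀ l ∈ E, k < l → i ∉ unselected T φ l) with hD
  have hDsub : ∀ k, D k ⊆ unselected T φ k := fun k => Finset.filter_subset _ _
  have hdisj : (E : Set ℕ).PairwiseDisjoint D := by
    have aux : ∀ k ∈ E, ∀ l ∈ E, k < l → Disjoint (D k) (D l) := by
      intro k _ l hl hkl
      rw [Finset.disjoint_left]
      intro i hi hi'
      exact (Finset.mem_filter.1 hi).2 l hl hkl (hDsub l hi')
    intro k hk l hl hkl
    rcases lt_or_gt_of_ne hkl with h | h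
    · exact aux k hk l hl h
    · exact (aux l hl k hk h).symm
  have hDmass : ∀ k ∈ E, M k / 2 ≤ ∑ i ∈ D k, ‖x i‖ := by
    intro k hk
    have hsplit : M k = ∑ i ∈ D k, ‖x i‖ + ∑ i ∈ (unselected T φ k).filter
        (fun i => ¬ ∀ l ∈ E, k < l → i ∉ unselected T φ l), ‖x i‖ :=
      (Finset.sum_filter_add_sum_filter_not _ _ _).symm
    suffices h : ∑ i ∈ (unselected T φ k).filter
        (fun i => ¬ ∀ l ∈ E, k < l → i ∉ unselected T φ l), ‖x i‖ ≤ M k / 2 by linarith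
    rcases (E.filter (fun l => k < l)).eq_empty_or_nonempty with h0 | h0
    · rw [Finset.filter_eq_empty_iff.2, Finset.sum_empty]
      · linarith [hM0 k]
      · intro i _
        push Not
        intro l hl hkl
        have := Finset.filter_eq_empty_iff.1 h0 hl
        exact absurd hkl this
    · have hmem := Finset.mem_filter.1 (Finset.min'_mem _ h0)
      refine le_trans ?_ (hEM k hk _ hmem.1 hmem.2)
      refine Finset.sum_le_sum_of_subset_of_nonneg ?_ fun _ _ _ => norm_nonneg _
      intro i hi
      have hi := (Finset.mem_filter.1 hi).2
      push Not at hi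
      obtain ⟨l, hl, hkl, hil⟩ := hi
      exact unselected_anti T φ (Finset.min'_le _ l (Finset.mem_filter.2 ⟨hl, hkl⟩)) hil
  have key := sum_coeff_rpow_le hX hq.le hW.le hinc E (fun k i => (a k : 𝕜) * c k i) D
    (fun k _ => (hDsub k).trans Finset.sdiff_subset) hdisj
  set S := ∑ k ∈ E, s k ^ q' with hS
  have hS0 : 0 ≤ S := Finset.sum_nonneg fun k _ => Real.rpow_nonneg (hs0 k) _
  have hlow : S / 2 ≤ ∑ k ∈ E, ∑ i ∈ D k, ‖(a k : 𝕜) * c k i‖ := by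
    rw [hS, Finset.sum_div]
    refine Finset.sum_le_sum fun k hk => ?_
    have hρk := hρpos k (hE k hk)
    calc s k ^ q' / 2 ≤ a k * (M k / 2) := by
          have : a k * (M k / 2) = s k ^ (q' - 1) * s k / 2 := by
            simp only [ha, hs]; ring
          rw [this]
          rcases (hs0 k).eq_or_lt with h | h
          · rw [← h, Real.zero_rpow (by rw [hq']; positivity)]; simp
          · rw [Real.rpow_sub_one h.ne']; field_simp; exact le_rfl
      _ ≤ a k * ∑ i ∈ D k, ‖x i‖ := by
          gcongr
          · exact ha0 k
          · exact hDmass k hk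
      _ = _ := by
          rw [Finset.mul_sum]
          refine Finset.sum_congr rfl fun i hi => ?_
          rw [norm_mul, RCLike.norm_ofReal, abs_of_nonneg (ha0 k),
            (hc k (hE k hk).le).1 i (hDsub k hi)]
  have hup : ∑ k ∈ E, ‖∑ i ∈ T ∪ (Finset.range n).image φ, ((a k : 𝕜) * c k i) • g i‖ ^ q ≤
      2 ^ q * S := by
    rw [hS, Finset.mul_sum]
    refine Finset.sum_le_sum fun k hk => ?_
    have hρk := hρpos k (hE k hk)
    have h1 : ∑ i ∈ T ∪ (Finset.range n).image φ, ((a k : 𝕜) * c k i) • g i =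
        (a k : 𝕜) • (f - G k) := by
      rw [← (hc k (hE k hk).le).2, Finset.smul_sum]
      simp only [mul_smul]
    have h2 : ‖f - G k‖ ≤ 2 * ‖f₀ - G k‖ := by
      have h3 : f - G k = (f₀ - G k) - (f₀ - f) := by abel
      rw [h3]
      have := norm_sub_le (f₀ - G k) (f₀ - f)
      linarith [hρ k (hE k hk), norm_nonneg (f₀ - f)]
    rw [h1, norm_smul, RCLike.norm_ofReal, abs_of_nonneg (ha0 k)]
    calc (a k * ‖f - G k‖) ^ q ≤ (2 * s k ^ (q' - 1)) ^ q := by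
          refine Real.rpow_le_rpow (mul_nonneg (ha0 k) (norm_nonneg _)) ?_ (by linarith)
          calc a k * ‖f - G k‖ ≤ a k * (2 * ‖f₀ - G k‖) := by
                gcongr; exact ha0 k
            _ = 2 * s k ^ (q' - 1) := by simp only [ha]; field_simp
      _ = 2 ^ q * s k ^ q' := by
          rw [Real.mul_rpow (by norm_num) (Real.rpow_nonneg (hs0 k) _),
            ← Real.rpow_mul (hs0 k), hq'1]
  have hfin : (S / 2) ^ q ≤ W ^ q * (K * (2 ^ q * S)) := by
    refine (Real.rpow_le_rpow (by positivity) hlow (by linarith)).trans (key.trans ?_)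
    gcongr
  change S ≤ _
  rcases hS0.eq_or_lt with h0 | hSpos
  · rw [← h0]; positivity
  have h4 : S ^ (q - 1) ≤ 4 ^ q * K * W ^ q := by
    rw [Real.div_rpow hS0 (by norm_num), div_le_iff₀ (by positivity)] at hfin
    rw [Real.rpow_sub_one hSpos.ne', div_le_iff₀ hSpos]
    calc S ^ q ≤ _ := hfin
      _ = _ := by
        have : (4 : ℝ) ^ q = 2 ^ q * 2 ^ q := by
          rw [← Real.mul_rpow (by norm_num) (by norm_num)]; norm_num
        rw [this]; ring
  calc S = (S ^ (q - 1)) ^ (1 / (q - 1)) := by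
        rw [← Real.rpow_mul hS0, mul_one_div_cancel hq1.ne', Real.rpow_one]
    _ ≤ _ := Real.rpow_le_rpow (by positivity) h4 (by positivity)

/-- The number of steps during which the residual stays above four times the error of a given
sparse approximant. -/
theorem IsWCGA.card_steps_le (hG : IsWCGA (𝕜 := 𝕜) t g f₀ φ G) {q K W : ℝ}
    (hX : PowerSmooth X q K) (hq : 1 < q) (hq2 : q ≤ 2) (hK : 0 < K) (ht : 0 < t)
    (hg : ∀ i, ‖g i‖ ≤ 2) (hW : 1 ≤ W) (T : Finset ι) (x : ι → 𝕜) {n : ℕ}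
    (hinc : ∀ c : ι → 𝕜, ∑ i ∈ T, ‖c i‖ ≤
      W * ‖∑ i ∈ T ∪ (Finset.range n).image φ, c i • g i‖)
    (hρ : ∀ k < n, 4 * ‖f₀ - ∑ i ∈ T, x i • g i‖ < ‖f₀ - G k‖) :
    (n : ℝ) ≤ 2 * (1 / (1 / 4) ^ (q / (q - 1)) +
      Real.log (16 * W) / (gain q K * (t / 2) ^ (q / (q - 1)) / q)) *
      (4 ^ q * K * W ^ q) ^ (1 / (q - 1)) := by
  set f := ∑ i ∈ T, x i • g i with hf
  set M := unselectedMass x T φ with hM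
  have hq1 : 0 < q - 1 := by linarith
  have hρpos : ∀ k < n, 0 < ‖f₀ - G k‖ := fun k hk => lt_of_le_of_lt (by positivity) (hρ k hk)
  have hρM : ∀ k < n, ‖f₀ - G k‖ ≤ 4 * M k := by
    intro k hk
    have h1 := hG.residual_le hg T x k
    have h2 := hρ k hk
    rw [← hf] at h1
    linarith [hρpos k hk]
  have hMpos : ∀ k < n, 0 < M k := fun k hk => by linarith [hρM k hk, hρpos k hk]
  have hMρ : ∀ k < n, M k ≤ 2 * W * ‖f₀ - G k‖ := by
    intro k hk
    obtain ⟨c, hc1, hc2⟩ := exists_coeff_sub_of_mem_chosenSpan hk.le (hG.mem k) x T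
    calc M k = ∑ i ∈ unselected T φ k, ‖c i‖ :=
          Finset.sum_congr rfl fun i hi => by rw [hc1 i hi]
      _ ≤ ∑ i ∈ T, ‖c i‖ := Finset.sum_le_sum_of_subset_of_nonneg Finset.sdiff_subset
          fun _ _ _ => norm_nonneg _
      _ ≤ W * ‖f - G k‖ := by rw [← hc2]; exact hinc c
      _ ≤ W * (2 * ‖f₀ - G k‖) := by
          gcongr
          have h3 : f - G k = (f₀ - G k) - (f₀ - f) := by abel
          rw [h3]
          have := norm_sub_le (f₀ - G k) (f₀ - f)
          linarith [hρ k hk, norm_nonneg (f₀ - f)]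
      _ = _ := by ring
  have hlog : ∀ k < n, ∀ l < n, ⌊Real.logb 2 (M k)⌋ = ⌊Real.logb 2 (M l)⌋ → M k ≤ 2 * M l := by
    intro k hk l hl h
    have h1 := Int.lt_floor_add_one (Real.logb 2 (M k))
    have h2 := Int.floor_le (Real.logb 2 (M l))
    rw [h] at h1
    have h3 : Real.logb 2 (M k) ≤ Real.logb 2 (2 * M l) := by
      rw [Real.logb_mul (by norm_num) (hMpos l hl).ne', Real.logb_self_eq_one (by norm_num)]
      linarith
    exact (Real.logb_le_logb (by norm_num) (hMpos k hk) (by linarith [hMpos l hl])).1 h3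
  have hθ : 0 < gain q K * (t / 2) ^ (q / (q - 1)) / q := by
    have := gain_pos (q := q) hK
    positivity
  refine card_steps_le_of_levels (j := fun k => ⌊Real.logb 2 (M k)⌋)
    (L := fun k => - Real.log ‖f₀ - G k‖)
    (z := fun k => (M k / ‖f₀ - G k‖) ^ (q / (q - 1))) hθ (by positivity)
    (Real.log_nonneg (by linarith)) ?_ ?_ ?_ ?_ ?_
  · intro k l hkl hl
    refine Int.floor_le_floor ?_
    exact Real.logb_le_logb_of_le (by norm_num) (hMpos l hl) (unselectedMass_anti x T φ hkl)
  · intro k hk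
    refine Real.rpow_le_rpow (by norm_num) ?_ (by positivity)
    rw [le_div_iff₀ (hρpos k hk)]
    linarith [hρM k hk]
  · intro k hk
    have := hG.log_residual_succ_le hX hq hq2 hK ht hg T x (hρ k (by omega)) (hρpos _ hk)
      (hMpos k (by omega))
    rw [← hM] at this
    linarith
  · intro k hk l hl hkl
    have h1 : ‖f₀ - G k‖ ≤ 16 * W * ‖f₀ - G l‖ := by
      have h2 := hlog k hk l hl hkl
      linarith [hρM k hk, hMρ l hl]
    have h2 := Real.log_le_log (hρpos k hk) h1
    rw [Real.log_mul (by positivity) (hρpos l hl).ne'] at h2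
    linarith
  · intro E hE hEj
    refine hG.sum_ratio_rpow_le hX hq hK (by linarith) T x hinc hρ E hE ?_
    intro k hk l hl hkl
    have h0 := hEj k hk l hl hkl
    have h1 := Int.lt_floor_add_one (Real.logb 2 (M l))
    have h2 := Int.floor_le (Real.logb 2 (M k))
    have h3 : ((⌊Real.logb 2 (M l)⌋ : ℝ)) + 2 ≤ ⌊Real.logb 2 (M k)⌋ := by exact_mod_cast h0
    have hMk := hMpos k (hE k hk)
    refine (Real.logb_le_logb (b := 2) (by norm_num) (hMpos l (hE l hl)) (by positivity)).1 ?_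
    rw [Real.logb_div hMk.ne' (by norm_num), Real.logb_self_eq_one (by norm_num)]
    linarith

end Lebesgue

/-! ### Smoothness of the spaces `L_p` -/

section Smooth

theorem rpow_midpoint_le {u w s : ℝ} (hs : 1 ≤ s) (hu : 0 ≤ u) (hw : 0 ≤ w) :
    ((u + w) / 2) ^ s ≤ (u ^ s + w ^ s) / 2 := by
  have h := (convexOn_rpow hs).2 (Set.mem_Ici.2 hu) (Set.mem_Ici.2 hw)
    (by norm_num : (0 : ℝ) ≤ 1 / 2) (by norm_num : (0 : ℝ) ≤ 1 / 2) (by norm_num)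
  simp only [smul_eq_mul] at h
  calc ((u + w) / 2) ^ s = (1 / 2 * u + 1 / 2 * w) ^ s := by congr 1; ring
    _ ≤ _ := h
    _ = _ := by ring

variable {𝕜 : Type*} [RCLike 𝕜]

theorem norm_add_sq_add_norm_sub_sq (a b : 𝕜) :
    ‖a + b‖ ^ 2 + ‖a - b‖ ^ 2 = 2 * (‖a‖ ^ 2 + ‖b‖ ^ 2) := by
  have := parallelogram_law_with_norm 𝕜 a b
  simpa only [sq] using this

theorem norm_rpow_eq_sq_rpow {E : Type*} [SeminormedAddCommGroup E] (a : E) (p : ℝ) :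
    ‖a‖ ^ p = (‖a‖ ^ 2) ^ (p / 2) := by
  rw [← Real.rpow_natCast, ← Real.rpow_mul (norm_nonneg _)]
  congr 1
  push_cast
  ring

theorem norm_add_rpow_add_norm_sub_rpow_le_of_le_two {p : ℝ} (hp : 0 < p) (hp2 : p ≤ 2) (a b : 𝕜) :
    ‖a + b‖ ^ p + ‖a - b‖ ^ p ≤ 2 * ‖a‖ ^ p + 2 * ‖b‖ ^ p := by
  have h1 : (1 : ℝ) ≤ 2 / p := by rw [le_div_iff₀ hp]; linarith
  have h := rpow_midpoint_le h1 (Real.rpow_nonneg (norm_nonneg (a + b)) p)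
    (Real.rpow_nonneg (norm_nonneg (a - b)) p)
  have hsq : ∀ z : 𝕜, (‖z‖ ^ p) ^ (2 / p) = ‖z‖ ^ 2 := fun z => by
    rw [← Real.rpow_mul (norm_nonneg _), mul_div_cancel₀ _ hp.ne', Real.rpow_two]
  rw [hsq, hsq, norm_add_sq_add_norm_sub_sq, mul_div_cancel_left₀ _ (by norm_num)] at h
  have h2 := Real.rpow_le_rpow (by positivity) h (by positivity : 0 ≤ p / 2)
  rw [← Real.rpow_mul (by positivity), div_mul_div_cancel₀ hp.ne', div_self (by norm_num),
    Real.rpow_one] at h2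
  have h3 := Real.rpow_add_le_add_rpow (sq_nonneg ‖a‖) (sq_nonneg ‖b‖)
    (by positivity : 0 ≤ p / 2) (by linarith)
  rw [← norm_rpow_eq_sq_rpow, ← norm_rpow_eq_sq_rpow] at h3
  linarith

theorem one_add_rpow_add_one_sub_rpow_le {s z : ℝ} (hs : 0 < s) (hz1 : -1 ≤ z) (hz2 : z ≤ 1) :
    ((1 + z) ^ s + (1 - z) ^ s) / 2 ≤ (1 + (Real.exp (s / 2) - 1) * z ^ 2) ^ s := by
  have h1 : ∀ w : ℝ, -1 ≤ w → (1 + w) ^ s ≤ Real.exp (s * w) := by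
    intro w hw
    calc (1 + w) ^ s ≤ (Real.exp w) ^ s :=
          Real.rpow_le_rpow (by linarith) (by linarith [Real.add_one_le_exp w]) hs.le
      _ = _ := by rw [← Real.exp_mul, mul_comm]
  have h2 := h1 z hz1
  have h3 := h1 (-z) (by linarith)
  rw [← sub_eq_add_neg, mul_neg] at h3
  have h4 := Real.cosh_le_exp_half_sq (s * z)
  rw [Real.cosh_eq] at h4
  have hz : z ^ 2 ≤ 1 := by nlinarith
  -- convexity of `exp` on the segment from `0` to `s / 2`
  have h5 : Real.exp (z ^ 2 * (s / 2)) ≤ 1 + (Real.exp (s / 2) - 1) * z ^ 2 := by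
    have := convexOn_exp.2 (Set.mem_univ (0 : ℝ)) (Set.mem_univ (s / 2))
      (by linarith : 0 ≤ 1 - z ^ 2) (sq_nonneg z) (by ring)
    simp only [smul_eq_mul, mul_zero, zero_add, Real.exp_zero, mul_one] at this
    linarith
  calc _ ≤ Real.exp ((s * z) ^ 2 / 2) := by linarith
    _ = (Real.exp (z ^ 2 * (s / 2))) ^ s := by
        rw [← Real.exp_mul]; congr 1; ring
    _ ≤ _ := Real.rpow_le_rpow (Real.exp_pos _).le h5 hs.le

/-- A two-point hypercontractive inequality, with a constant that is not optimal. -/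
theorem norm_add_rpow_add_norm_sub_rpow_le_of_two_le {p : ℝ} (hp : 2 ≤ p) (a b : 𝕜) :
    (‖a + b‖ ^ p + ‖a - b‖ ^ p) / 2 ≤
      (‖a‖ ^ 2 + 4 * Real.exp (p / 4) * ‖b‖ ^ 2) ^ (p / 2) := by
  have hs : 0 < p / 2 := by linarith
  have hpar := norm_add_sq_add_norm_sub_sq a b
  rw [norm_rpow_eq_sq_rpow (a + b), norm_rpow_eq_sq_rpow (a - b)]
  set A := ‖a‖ ^ 2 + ‖b‖ ^ 2 with hA
  have hA0 : 0 ≤ A := by positivity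
  rcases hA0.eq_or_lt with h0 | hApos
  · have h1 : ‖a + b‖ ^ 2 = 0 := by nlinarith [sq_nonneg ‖a + b‖, sq_nonneg ‖a - b‖]
    have h2 : ‖a - b‖ ^ 2 = 0 := by nlinarith [sq_nonneg ‖a + b‖, sq_nonneg ‖a - b‖]
    rw [h1, h2, Real.zero_rpow hs.ne']
    simp only [add_zero, zero_div]
    positivity
  set z := (‖a + b‖ ^ 2 - A) / A with hz
  have hzA : z * A = ‖a + b‖ ^ 2 - A := by rw [hz]; field_simp
  have e1 : ‖a + b‖ ^ 2 = A * (1 + z) := by linarith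
  have e2 : ‖a - b‖ ^ 2 = A * (1 - z) := by linarith
  have hz1 : -1 ≤ z := by
    by_contra h
    nlinarith [sq_nonneg ‖a + b‖]
  have hz2 : z ≤ 1 := by
    by_contra h
    nlinarith [sq_nonneg ‖a - b‖]
  have u1 : z * A ≤ 2 * ‖a‖ * ‖b‖ := by
    nlinarith [norm_add_le a b, norm_nonneg (a + b), norm_nonneg a, norm_nonneg b]
  have u2 : -(z * A) ≤ 2 * ‖a‖ * ‖b‖ := by
    nlinarith [norm_sub_le a b, norm_nonneg (a - b), norm_nonneg a, norm_nonneg b]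
  have u3 : A * z ^ 2 ≤ 4 * ‖b‖ ^ 2 := by
    have h1 : (z * A) ^ 2 ≤ (2 * ‖a‖ * ‖b‖) ^ 2 := sq_le_sq' (by linarith) u1
    have h2 : A * (A * z ^ 2) ≤ A * (4 * ‖b‖ ^ 2) := by
      nlinarith [sq_nonneg (‖b‖ ^ 2)]
    exact le_of_mul_le_mul_left h2 hApos
  have h1 := one_add_rpow_add_one_sub_rpow_le hs hz1 hz2
  have hC : 0 ≤ Real.exp (p / 2 / 2) - 1 := by
    linarith [Real.add_one_le_exp (p / 2 / 2)]
  have hp4 : p / 2 / 2 = p / 4 := by ring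
  rw [e1, e2, Real.mul_rpow hA0 (by linarith), Real.mul_rpow hA0 (by linarith)]
  calc _ = A ^ (p / 2) * (((1 + z) ^ (p / 2) + (1 - z) ^ (p / 2)) / 2) := by ring
    _ ≤ A ^ (p / 2) * (1 + (Real.exp (p / 2 / 2) - 1) * z ^ 2) ^ (p / 2) := by gcongr
    _ = (A * (1 + (Real.exp (p / 2 / 2) - 1) * z ^ 2)) ^ (p / 2) := by
        rw [Real.mul_rpow hA0 (by positivity)]
    _ ≤ _ := by
        refine Real.rpow_le_rpow (by positivity) ?_ hs.le
        rw [hp4] at hC ⊢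
        nlinarith [mul_le_mul_of_nonneg_left u3 hC, sq_nonneg ‖b‖]

variable {α : Type*} [MeasurableSpace α] {ν : Measure α}

theorem Lp_norm_rpow {E : Type*} [NormedAddCommGroup E] {p : ℝ} (hp : 0 < p)
    (f : Lp E (ENNReal.ofReal p) ν) : ‖f‖ ^ p = ∫ a, ‖f a‖ ^ p ∂ν := by
  have h0 : 0 ≤ ∫ a, ‖f a‖ ^ p ∂ν := integral_nonneg fun a => by positivity
  rw [Lp.norm_def, MemLp.eLpNorm_eq_integral_rpow_norm (by simpa using hp) ENNReal.ofReal_ne_top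
    (Lp.memLp f), ENNReal.toReal_ofReal hp.le, ENNReal.toReal_ofReal (by positivity),
    ← Real.rpow_mul h0, inv_mul_cancel₀ hp.ne', Real.rpow_one]

theorem integrable_Lp_norm_rpow {E : Type*} [NormedAddCommGroup E] {p : ℝ} (hp : 0 < p)
    (f : Lp E (ENNReal.ofReal p) ν) : Integrable (fun a => ‖f a‖ ^ p) ν := by
  have := (Lp.memLp f).integrable_norm_rpow (by simpa using hp) ENNReal.ofReal_ne_top
  rwa [ENNReal.toReal_ofReal hp.le] at this

theorem norm_add_rpow_add_norm_sub_rpow_eq {p : ℝ} (hp : 0 < p)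
    (f g : Lp 𝕜 (ENNReal.ofReal p) ν) :
    ‖f + g‖ ^ p + ‖f - g‖ ^ p = ∫ a, (‖f a + g a‖ ^ p + ‖f a - g a‖ ^ p) ∂ν := by
  rw [Lp_norm_rpow hp, Lp_norm_rpow hp, ← integral_add (integrable_Lp_norm_rpow hp _)
    (integrable_Lp_norm_rpow hp _)]
  refine integral_congr_ae ?_
  filter_upwards [Lp.coeFn_add f g, Lp.coeFn_sub f g] with a h1 h2
  simp only [h1, h2, Pi.add_apply, Pi.sub_apply]

theorem powerSmooth_Lp_of_le_two {p : ℝ} [hp : Fact (1 < p)] (hp2 : p ≤ 2) :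
    PowerSmooth (Lp 𝕜 (ENNReal.ofReal p) ν) p 1 := by
  intro f g
  have hp0 : 0 < p := by linarith [hp.out]
  have hf := (integrable_Lp_norm_rpow hp0 f).const_mul 2
  have hg := (integrable_Lp_norm_rpow hp0 g).const_mul 2
  rw [norm_add_rpow_add_norm_sub_rpow_eq hp0, Lp_norm_rpow hp0 f, Lp_norm_rpow hp0 g, mul_one,
    ← integral_const_mul, ← integral_const_mul, ← integral_add hf hg]
  exact integral_mono_of_nonneg (Filter.Eventually.of_forall fun a => by positivity) (hf.add hg)
    (Filter.Eventually.of_forall fun a =>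
      norm_add_rpow_add_norm_sub_rpow_le_of_le_two hp0 hp2 (f a) (g a))

/-- Minkowski's inequality in `L_{p/2}` for the functions `‖f‖ ^ 2` and `K * ‖g‖ ^ 2`. -/
theorem integral_sq_add_sq_rpow_le {p : ℝ} (hp : 2 ≤ p) {K : ℝ} (hK : 0 ≤ K)
    (f g : Lp 𝕜 (ENNReal.ofReal p) ν) :
    Integrable (fun a => (‖f a‖ ^ 2 + K * ‖g a‖ ^ 2) ^ (p / 2)) ν ∧
    ∫ a, (‖f a‖ ^ 2 + K * ‖g a‖ ^ 2) ^ (p / 2) ∂ν ≤ (‖f‖ ^ 2 + K * ‖g‖ ^ 2) ^ (p / 2) := by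
  have hp0 : 0 < p := by linarith
  have hs0 : 0 < p / 2 := by linarith
  have : Fact (1 ≤ ENNReal.ofReal p) :=
    ⟨by simpa using ENNReal.ofReal_le_ofReal (by linarith : (1 : ℝ) ≤ p)⟩
  have : Fact (1 ≤ ENNReal.ofReal (p / 2)) :=
    ⟨by simpa using ENNReal.ofReal_le_ofReal (by linarith : (1 : ℝ) ≤ p / 2)⟩
  have hmem : ∀ h : Lp 𝕜 (ENNReal.ofReal p) ν,
      MemLp (fun a => ‖h a‖ ^ 2) (ENNReal.ofReal (p / 2)) ν := by
    intro h
    have hmeas : AEStronglyMeasurable (fun a => ‖h a‖ ^ 2) ν :=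
      (Lp.aestronglyMeasurable h).norm.pow 2
    rw [← integrable_norm_rpow_iff hmeas (by simpa using hs0) ENNReal.ofReal_ne_top,
      ENNReal.toReal_ofReal hs0.le]
    refine (integrable_Lp_norm_rpow hp0 h).congr (Filter.Eventually.of_forall fun a => ?_)
    simp only [norm_pow, norm_norm]
    exact norm_rpow_eq_sq_rpow (h a) p
  have hnorm : ∀ h : Lp 𝕜 (ENNReal.ofReal p) ν, ‖(hmem h).toLp‖ = ‖h‖ ^ 2 := by
    intro h
    have h1 : ‖(hmem h).toLp‖ ^ (p / 2) = (‖h‖ ^ 2) ^ (p / 2) := by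
      rw [Lp_norm_rpow hs0, ← norm_rpow_eq_sq_rpow h p, Lp_norm_rpow hp0]
      refine integral_congr_ae ?_
      filter_upwards [(hmem h).coeFn_toLp] with a ha
      rw [ha, norm_rpow_eq_sq_rpow (h a) p]
      simp only [norm_pow, norm_norm]
    exact (Real.rpow_left_inj (norm_nonneg _) (by positivity) hs0.ne').1 h1
  set U := (hmem f).toLp + K • (hmem g).toLp with hU
  have hae : (fun a => ‖U a‖ ^ (p / 2)) =ᵐ[ν]
      fun a => (‖f a‖ ^ 2 + K * ‖g a‖ ^ 2) ^ (p / 2) := by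
    filter_upwards [Lp.coeFn_add (hmem f).toLp (K • (hmem g).toLp),
      Lp.coeFn_smul K (hmem g).toLp, (hmem f).coeFn_toLp, (hmem g).coeFn_toLp] with a h1 h2 h3 h4
    rw [hU, h1, Pi.add_apply, h2, Pi.smul_apply, h3, h4, smul_eq_mul, Real.norm_of_nonneg]
    positivity
  refine ⟨(integrable_Lp_norm_rpow hs0 U).congr hae, ?_⟩
  rw [← integral_congr_ae hae, ← Lp_norm_rpow hs0]
  refine Real.rpow_le_rpow (norm_nonneg _) ?_ hs0.le
  refine (norm_add_le _ _).trans ?_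
  rw [norm_smul, hnorm, hnorm, Real.norm_of_nonneg hK]

theorem powerSmooth_Lp_of_two_le {p : ℝ} [Fact (1 < p)] (hp : 2 ≤ p) :
    PowerSmooth (Lp 𝕜 (ENNReal.ofReal p) ν) 2 (4 * Real.exp (p / 4)) := by
  intro f g
  have hp0 : 0 < p := by linarith
  have hs0 : 0 < p / 2 := by linarith
  obtain ⟨hint, hle⟩ := integral_sq_add_sq_rpow_le hp (by positivity : 0 ≤ 4 * Real.exp (p / 4)) f g
  have h1 : (‖f + g‖ ^ p + ‖f - g‖ ^ p) / 2 ≤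
      (‖f‖ ^ 2 + 4 * Real.exp (p / 4) * ‖g‖ ^ 2) ^ (p / 2) := by
    refine le_trans ?_ hle
    rw [norm_add_rpow_add_norm_sub_rpow_eq hp0, ← integral_div]
    exact integral_mono_of_nonneg (Filter.Eventually.of_forall fun a => by positivity) hint
      (Filter.Eventually.of_forall fun a =>
        norm_add_rpow_add_norm_sub_rpow_le_of_two_le hp (f a) (g a))
  rw [norm_rpow_eq_sq_rpow (f + g), norm_rpow_eq_sq_rpow (f - g)] at h1
  have h2 := (rpow_midpoint_le (by linarith : 1 ≤ p / 2) (sq_nonneg ‖f + g‖)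
    (sq_nonneg ‖f - g‖)).trans h1
  have h3 := (Real.rpow_le_rpow_iff (by positivity) (by positivity) hs0).1 h2
  simp only [Real.rpow_two]
  linarith

theorem powerSmooth_Lp (p : ℝ) [hp : Fact (1 < p)] :
    PowerSmooth (Lp 𝕜 (ENNReal.ofReal p) ν) (min p 2) (4 * Real.exp (p / 4)) := by
  rcases le_total p 2 with h | h
  · rw [min_eq_left h]
    intro f g
    refine (powerSmooth_Lp_of_le_two h f g).trans ?_
    gcongr
    linarith [Real.add_one_le_exp (p / 4), hp.out]
  · rw [min_eq_right h]
    exact powerSmooth_Lp_of_two_le h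

end Smooth

/-! ### The norms of continuous functions for the three measures -/

section Norms

theorem continuous_norm_rpow {α : Type*} [TopologicalSpace α] {𝕜 : Type*} [RCLike 𝕜] (p : ℝ)
    [hp : Fact (1 < p)] (f : C(α, 𝕜)) : Continuous fun a => ‖f a‖ ^ p :=
  f.continuous.norm.rpow_const fun _ => Or.inr (by linarith [hp.out])

variable {α : Type*} [MeasurableSpace α] [TopologicalSpace α] [CompactSpace α] [BorelSpace α]
  {𝕜 : Type*} [RCLike 𝕜] (p : ℝ) [hp : Fact (1 < p)]

theorem norm_toLp_rpow (ν : Measure α) [IsFiniteMeasure ν] (f : C(α, 𝕜)) :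
    ‖toLp p ν f‖ ^ p = ∫ a, ‖f a‖ ^ p ∂ν := by
  rw [Lp_norm_rpow (by linarith [hp.out])]
  refine integral_congr_ae ?_
  filter_upwards [ContinuousMap.coeFn_toLp (p := ENNReal.ofReal p) (𝕜 := 𝕜) ν f] with a ha
  rw [ha]

theorem integrable_norm_rpow (ν : Measure α) [IsFiniteMeasure ν] (f : C(α, 𝕜)) :
    Integrable (fun a => ‖f a‖ ^ p) ν := by
  obtain ⟨C, hC⟩ := (isCompact_range (continuous_norm_rpow p f)).bddAbove
  refine Integrable.of_bound (continuous_norm_rpow p f).aestronglyMeasurable C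
    (Filter.Eventually.of_forall fun a => ?_)
  rw [Real.norm_of_nonneg (by positivity)]
  exact hC ⟨a, rfl⟩

theorem norm_toLp_sampleMeasure_rpow {m : ℕ} (ξ : Fin m → α) (f : C(α, 𝕜)) :
    ‖toLp p (sampleMeasure ξ) f‖ ^ p = 1 / (m : ℝ) * ∑ j, ‖f (ξ j)‖ ^ p := by
  rw [norm_toLp_rpow, sampleMeasure, integral_smul_nnreal_measure,
    integral_finsetSum_measure fun j _ => integrable_norm_rpow p _ f, NNReal.smul_def]
  simp only [integral_dirac' _ _ (continuous_norm_rpow p f).stronglyMeasurable]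
  simp

theorem norm_toLp_mixedMeasure_rpow (μ : Measure α) [IsFiniteMeasure μ] {m : ℕ} (ξ : Fin m → α)
    (f : C(α, 𝕜)) :
    ‖toLp p (mixedMeasure μ ξ) f‖ ^ p =
      (‖toLp p μ f‖ ^ p + ‖toLp p (sampleMeasure ξ) f‖ ^ p) / 2 := by
  rw [norm_toLp_rpow, norm_toLp_rpow, norm_toLp_rpow, mixedMeasure, integral_smul_nnreal_measure,
    integral_add_measure (integrable_norm_rpow p _ f) (integrable_norm_rpow p _ f),
    NNReal.smul_def]
  simp
  ring

theorem le_two_mul_of_rpow_le {p a b : ℝ} (hp : 1 < p) (ha : 0 ≤ a) (hb : 0 ≤ b)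
    (h : a ^ p ≤ 2 * b ^ p) : a ≤ 2 * b := by
  refine (Real.rpow_le_rpow_iff ha (by positivity) (by linarith : 0 < p)).1 (h.trans ?_)
  rw [Real.mul_rpow (by norm_num) hb]
  gcongr
  calc (2 : ℝ) = 2 ^ (1 : ℝ) := by norm_num
    _ ≤ 2 ^ p := Real.rpow_le_rpow_of_exponent_le (by norm_num) hp.le

theorem norm_toLp_le_two_mul_mixed (μ : Measure α) [IsFiniteMeasure μ] {m : ℕ} (ξ : Fin m → α)
    (f : C(α, 𝕜)) :
    ‖toLp p μ f‖ ≤ 2 * ‖toLp p (mixedMeasure μ ξ) f‖ ∧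
      ‖toLp p (sampleMeasure ξ) f‖ ≤ 2 * ‖toLp p (mixedMeasure μ ξ) f‖ := by
  have h := norm_toLp_mixedMeasure_rpow p μ ξ f
  have h1 : 0 ≤ ‖toLp p μ f‖ ^ p := by positivity
  have h2 : 0 ≤ ‖toLp p (sampleMeasure ξ) f‖ ^ p := by positivity
  exact ⟨le_two_mul_of_rpow_le hp.out (norm_nonneg _) (norm_nonneg _) (by linarith),
    le_two_mul_of_rpow_le hp.out (norm_nonneg _) (norm_nonneg _) (by linarith)⟩

/-- Universal discretization passes from sets of exactly `u` elements to smaller sets. -/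
theorem UniversalDiscretization.sum_bounds {p : ℝ} [Fact (1 < p)] {μ : Measure α}
    [IsFiniteMeasure μ] {m u N : ℕ} {ξ : Fin m → α} {g : Fin N → C(α, 𝕜)}
    (h : UniversalDiscretization p μ ξ (spans 𝕜 u g)) (huN : u ≤ N) {B : Finset (Fin N)}
    (hB : B.card ≤ u) (c : Fin N → 𝕜) :
    ‖toLp p μ (∑ i ∈ B, c i • g i)‖ ^ p ≤
        2 * ‖toLp p (sampleMeasure ξ) (∑ i ∈ B, c i • g i)‖ ^ p ∧
      ‖toLp p (sampleMeasure ξ) (∑ i ∈ B, c i • g i)‖ ^ p ≤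
        2 * ‖toLp p μ (∑ i ∈ B, c i • g i)‖ ^ p := by
  obtain ⟨J, hBJ, hJ⟩ := Finset.exists_superset_card_eq hB (by simpa using huN)
  have h1 := h _ ⟨J, hJ, rfl⟩ (∑ i ∈ B, c i • g i) (Submodule.sum_mem _ fun i hi =>
    Submodule.smul_mem _ _ (Submodule.subset_span ⟨i, hBJ hi, rfl⟩))
  rw [← norm_toLp_sampleMeasure_rpow] at h1
  have h0 : 0 ≤ ‖toLp p μ (∑ i ∈ B, c i • g i)‖ ^ p := by positivity
  constructor <;> linarith [h1.1, h1.2]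

end Norms

/-! ### Sampling recovery -/

/-- A constant `c` in `stepCount` which is large enough for the greedy algorithm in `L_p`: its
terms absorb the constants in `IsWCGA.card_steps_le`, and the lower bound `(1 - 1 / p) * log 2` for
`log (2 * V * v)` is used to absorb additive constants. -/
noncomputable def stepConst (p t : ℝ) : ℝ :=
  let q := min p 2
  let K := 4 * Real.exp (p / 4)
  let θ := gain q K * (t / 2) ^ (q / (q - 1)) / q
  let β := (1 - 1 / p) * Real.log 2
  1 + 2 * (1 / (1 / 4) ^ (q / (q - 1)) / β + (Real.log 16 / β + 1) / θ) *
    (4 ^ q * K) ^ (1 / (q - 1))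

theorem stepConst_aux {p t : ℝ} (hp : 1 < p) (ht : 0 < t) :
    0 < min p 2 - 1 ∧ 0 < (1 - 1 / p) * Real.log 2 ∧
      0 < gain (min p 2) (4 * Real.exp (p / 4)) * (t / 2) ^ (min p 2 / (min p 2 - 1)) /
        min p 2 := by
  have hq : 1 < min p 2 := lt_min hp (by norm_num)
  refine ⟨by linarith, ?_, ?_⟩
  · have : 1 / p < 1 := by rw [div_lt_one (by linarith)]; exact hp
    exact mul_pos (by linarith) (Real.log_pos (by norm_num))
  · have := gain_pos (q := min p 2) (K := 4 * Real.exp (p / 4)) (by positivity)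
    positivity

theorem one_le_stepConst {p t : ℝ} (hp : 1 < p) (ht : 0 < t) : 1 ≤ stepConst p t := by
  obtain ⟨h1, h2, h3⟩ := stepConst_aux hp ht
  have h4 : 0 ≤ Real.log 16 := Real.log_nonneg (by norm_num)
  unfold stepConst
  simp only [le_add_iff_nonneg_right]
  positivity

/-- With the constant `stepConst p t`, the number of steps exceeds the bound of
`IsWCGA.card_steps_le`. -/
theorem lt_stepCount {p t V r W : ℝ} {v : ℕ} (hp : 1 < p) (ht : 0 < t) (hV : 0 < V) (hv : 1 ≤ v)
    (hlog : (1 - 1 / p) * Real.log 2 ≤ Real.log (2 * V * v)) (hW : 0 < W)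
    (hW1 : W ≤ 2 * V * (v : ℝ) ^ r) (hW2 : W ≤ 2 * V * v) :
    2 * (1 / (1 / 4) ^ (min p 2 / (min p 2 - 1)) + Real.log (16 * W) /
        (gain (min p 2) (4 * Real.exp (p / 4)) * (t / 2) ^ (min p 2 / (min p 2 - 1)) / min p 2)) *
      (4 ^ min p 2 * (4 * Real.exp (p / 4)) * W ^ min p 2) ^ (1 / (min p 2 - 1)) <
    stepCount p (stepConst p t) V r v := by
  obtain ⟨hq1, hβ, hθ⟩ := stepConst_aux hp ht
  refine lt_of_lt_of_le ?_ (Nat.le_ceil _)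
  unfold stepConst
  set q := min p 2
  set K := 4 * Real.exp (p / 4) with hK
  set θ := gain q K * (t / 2) ^ (q / (q - 1)) / q
  set β := (1 - 1 / p) * Real.log 2
  set Λ := Real.log (2 * V * v)
  have hΛ : 0 < Λ := hβ.trans_le hlog
  have hΛβ : 1 ≤ Λ / β := by rw [le_div_iff₀ hβ]; linarith
  have hvpos : (0 : ℝ) < v := by exact_mod_cast hv
  set Z := (2 * V * (v : ℝ) ^ r) ^ (q / (q - 1))
  have hZ : 0 < Z := by positivity
  have hlog16 : 0 ≤ Real.log 16 := Real.log_nonneg (by norm_num)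
  have hWZ : (W ^ q) ^ (1 / (q - 1)) ≤ Z := by
    rw [← Real.rpow_mul hW.le, mul_one_div]
    have : 0 < q := by linarith
    exact Real.rpow_le_rpow hW.le hW1 (by positivity)
  have hlogW : Real.log (16 * W) ≤ (Real.log 16 / β + 1) * Λ := by
    calc Real.log (16 * W) ≤ Real.log (16 * (2 * V * v)) :=
          Real.log_le_log (by positivity) (by gcongr)
      _ = Real.log 16 * 1 + Λ := by
          rw [mul_one]; exact Real.log_mul (by norm_num) (by positivity)
      _ ≤ Real.log 16 * (Λ / β) + Λ := by gcongr
      _ = _ := by ring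
  set b := 1 / (1 / 4 : ℝ) ^ (q / (q - 1)) with hb
  have hb0 : 0 < b := by positivity
  have hsum : b + Real.log (16 * W) / θ ≤ (b / β + (Real.log 16 / β + 1) / θ) * Λ := by
    calc b + Real.log (16 * W) / θ ≤ b * (Λ / β) + (Real.log 16 / β + 1) * Λ / θ := by
          gcongr
          exact le_mul_of_one_le_right hb0.le hΛβ
      _ = _ := by ring
  rw [Real.mul_rpow (by positivity) (by positivity)]
  set R := (4 ^ q * K) ^ (1 / (q - 1)) with hR
  have hR0 : 0 < R := by positivity
  calc 2 * (b + Real.log (16 * W) / θ) * (R * (W ^ q) ^ (1 / (q - 1)))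
      ≤ 2 * ((b / β + (Real.log 16 / β + 1) / θ) * Λ) * (R * Z) := by gcongr
    _ < 2 * ((b / β + (Real.log 16 / β + 1) / θ) * Λ) * (R * Z) + Z * Λ := by
        linarith [mul_pos hZ hΛ]
    _ = (1 + 2 * (b / β + (Real.log 16 / β + 1) / θ) * R) * Z * Λ := by ring

section Recovery

variable {α : Type*} [MeasurableSpace α] [TopologicalSpace α] [CompactSpace α] [BorelSpace α]
  {𝕜 : Type*} [RCLike 𝕜] {p : ℝ} [hp : Fact (1 < p)] {μ : Measure α} [IsFiniteMeasure μ]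
  {m N v₀ u S v : ℕ} {ξ : Fin m → α} {g : Fin N → C(α, 𝕜)} {V r : ℝ}

theorem toLp_sum_smul (ν : Measure α) [IsFiniteMeasure ν] (B : Finset (Fin N)) (c : Fin N → 𝕜) :
    toLp p ν (∑ i ∈ B, c i • g i) = ∑ i ∈ B, c i • toLp p ν (g i) := by
  simp only [map_sum, map_smul]

theorem toLp_sub (ν : Measure α) [IsFiniteMeasure ν] (f h : C(α, 𝕜)) :
    toLp p ν (f - h) = toLp p ν f - toLp p ν h := map_sub _ _ _

/-- Incoherence for a single element of norm at most `2 ^ (1 / p)` gives `V ≥ 2 ^ (-1 / p)`. -/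
theorem log_two_mul_le_of_incoherent (hV : 0 < V) (hv₀ : 1 ≤ v₀) (hS : 1 ≤ S)
    (hinc : Incoherent 𝕜 v₀ S V r (fun i => toLp p μ (g i))) {i : Fin N}
    (hg : ‖toLp p μ (g i)‖ ^ p ≤ 2) (hv : 1 ≤ v) :
    (1 - 1 / p) * Real.log 2 ≤ Real.log (2 * V * v) := by
  have hp0 : 0 < p := by linarith [hp.out]
  have h1 := hinc {i} {i} subset_rfl (by simpa using hv₀) (by simpa using hS) 1
  simp only [Pi.one_apply, norm_one, Finset.sum_singleton, Finset.card_singleton, Nat.cast_one,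
    Real.one_rpow, mul_one, one_smul] at h1
  have h2 : 1 ≤ V ^ p * 2 := by
    calc (1 : ℝ) = 1 ^ p := (Real.one_rpow p).symm
      _ ≤ (V * ‖toLp p μ (g i)‖) ^ p := Real.rpow_le_rpow zero_le_one h1 hp0.le
      _ = V ^ p * ‖toLp p μ (g i)‖ ^ p := Real.mul_rpow hV.le (norm_nonneg _)
      _ ≤ _ := by gcongr
  have h3 : 0 ≤ p * Real.log V + Real.log 2 := by
    rw [← Real.log_rpow hV, ← Real.log_mul (by positivity) (by norm_num)]
    exact Real.log_nonneg h2
  have hv' : (1 : ℝ) ≤ v := by exact_mod_cast hv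
  calc (1 - 1 / p) * Real.log 2 ≤ Real.log 2 + Real.log V := by
        have : (p * Real.log V + Real.log 2) / p = Real.log V + 1 / p * Real.log 2 := by
          field_simp
        have h4 : 0 ≤ (p * Real.log V + Real.log 2) / p := by positivity
        linarith
    _ = Real.log (2 * V) := (Real.log_mul (by norm_num) hV.ne').symm
    _ ≤ _ := Real.log_le_log (by positivity) (le_mul_of_one_le_right (by positivity) hv')

/-- Incoherence in `L_p(μ)` gives, for the discrete norm, control of the coefficients on a set of
`v` elements by both `2 V v ^ r` and (adding up the bounds for single coefficients) `2 V v`. -/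
theorem sum_coeff_le_sample (hV : 0 < V) (hv₀ : 1 ≤ v₀) (huS : u ≤ S) (huN : u ≤ N) (hv : v ≤ v₀)
    (hinc : Incoherent 𝕜 v₀ S V r (fun i => toLp p μ (g i)))
    (hD : UniversalDiscretization p μ ξ (spans 𝕜 u g)) {T B : Finset (Fin N)} (hT : T.card = v)
    (hTB : T ⊆ B) (hB : B.card ≤ u) (c : Fin N → 𝕜) :
    ∑ i ∈ T, ‖c i‖ ≤ min (2 * V * (v : ℝ) ^ r) (2 * V * v) *
      ‖∑ i ∈ B, c i • toLp p (sampleMeasure ξ) (g i)‖ := by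
  have h1 := le_two_mul_of_rpow_le hp.out (norm_nonneg _) (norm_nonneg _)
    (hD.sum_bounds huN hB c).1
  rw [toLp_sum_smul, toLp_sum_smul] at h1
  rw [min_mul_of_nonneg _ _ (norm_nonneg _), le_min_iff]
  constructor
  · have h2 := hinc T B hTB (hT ▸ hv) (hB.trans huS) c
    rw [hT] at h2
    calc _ ≤ _ := h2
      _ ≤ V * (v : ℝ) ^ r * (2 * ‖∑ i ∈ B, c i • toLp p (sampleMeasure ξ) (g i)‖) := by gcongr
      _ = _ := by ring
  · calc ∑ i ∈ T, ‖c i‖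
        ≤ ∑ i ∈ T, V * (2 * ‖∑ i ∈ B, c i • toLp p (sampleMeasure ξ) (g i)‖) := by
          refine Finset.sum_le_sum fun i hi => ?_
          have h2 := hinc {i} B (Finset.singleton_subset_iff.2 (hTB hi)) (by simpa using hv₀)
            (hB.trans huS) c
          simp only [Finset.sum_singleton, Finset.card_singleton, Nat.cast_one, Real.one_rpow,
            mul_one] at h2
          exact h2.trans (by gcongr)
      _ = _ := by
          rw [Finset.sum_const, hT, nsmul_eq_mul]; ring

/-- The residual of the greedy algorithm in the discrete norm after `stepCount` steps. -/
theorem norm_residual_le {t : ℝ} (ht : 0 < t) (hV : 0 < V) (hr : 0 < r) (hv₀ : 1 ≤ v₀)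
    (huS : u ≤ S) (huN : u ≤ N)
    (hinc : Incoherent 𝕜 v₀ S V r (fun i => toLp p μ (g i)))
    (hD : UniversalDiscretization p μ ξ (spans 𝕜 u g))
    (hnorm : ∀ i, ‖toLp p μ (g i)‖ ≤ 1 ∨ ‖toLp p (sampleMeasure ξ) (g i)‖ ≤ 1)
    (hv1 : 1 ≤ v) (hv : v ≤ v₀) (hvu : v + stepCount p (stepConst p t) V r v ≤ u)
    {f₀ : C(α, 𝕜)} {φ : ℕ → Fin N} {Gm : ℕ → Lp 𝕜 (ENNReal.ofReal p) (sampleMeasure ξ)}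
    (hG : IsWCGA (𝕜 := 𝕜) t (fun i => toLp p (sampleMeasure ξ) (g i))
      (toLp p (sampleMeasure ξ) f₀) φ Gm) {T : Finset (Fin N)} (hT : T.card = v)
    (x : Fin N → 𝕜) :
    ‖toLp p (sampleMeasure ξ) f₀ - Gm (stepCount p (stepConst p t) V r v)‖ ≤
      4 * ‖toLp p (sampleMeasure ξ) f₀ - ∑ i ∈ T, x i • toLp p (sampleMeasure ξ) (g i)‖ := by
  classical
  have hp1 := hp.out
  have hu1 : 1 ≤ u := by omega
  have hbounds : ∀ i, ‖toLp p μ (g i)‖ ^ p ≤ 2 ∧ ‖toLp p (sampleMeasure ξ) (g i)‖ ≤ 2 := by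
    intro i
    have h := hD.sum_bounds huN (B := {i}) (by simpa using hu1) 1
    simp only [Finset.sum_singleton, Pi.one_apply, one_smul] at h
    have hone : ∀ a : ℝ, 0 ≤ a → a ≤ 1 → a ^ p ≤ 1 := fun a h0 h1 =>
      Real.rpow_le_one h0 h1 (by linarith)
    rcases hnorm i with h1 | h1
    · have h2 := hone _ (norm_nonneg _) h1
      refine ⟨by linarith, ?_⟩
      exact (le_two_mul_of_rpow_le hp1 (norm_nonneg _) (norm_nonneg _) h.2).trans (by linarith)
    · have h2 := hone _ (norm_nonneg _) h1
      exact ⟨by linarith [h.1], by linarith⟩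
  obtain ⟨i₀, -⟩ := Finset.card_pos.1 (hT ▸ hv1 : 0 < T.card)
  have hv' : (1 : ℝ) ≤ v := by exact_mod_cast hv1
  have hlogs : ∀ w : ℕ, 1 ≤ w → (1 - 1 / p) * Real.log 2 ≤ Real.log (2 * V * w) := fun w hw =>
    log_two_mul_le_of_incoherent hV hv₀ (hu1.trans huS) hinc (hbounds i₀).1 hw
  have hβ := (stepConst_aux hp1 ht).2.1
  have h2V : 1 ≤ 2 * V := by
    have h1 := hβ.trans_le (hlogs 1 le_rfl)
    rw [Nat.cast_one, mul_one] at h1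
    exact ((Real.log_pos_iff (by positivity)).1 h1).le
  have hvr : (1 : ℝ) ≤ (v : ℝ) ^ r := Real.one_le_rpow hv' hr.le
  have hW : 1 ≤ min (2 * V * (v : ℝ) ^ r) (2 * V * v) :=
    le_min (one_le_mul_of_one_le_of_one_le h2V hvr) (one_le_mul_of_one_le_of_one_le h2V hv')
  set n := stepCount p (stepConst p t) V r v with hn
  by_contra! hcon
  have hcard : (T ∪ (Finset.range n).image φ).card ≤ u := by
    refine (Finset.card_union_le _ _).trans ((Nat.add_le_add_left Finset.card_image_le _).trans ?_)
    rwa [Finset.card_range, hT]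
  have h1 := hG.card_steps_le (powerSmooth_Lp p) (lt_min hp1 (by norm_num)) (min_le_right _ _)
    (by positivity) ht (fun i => (hbounds i).2) hW T x (n := n)
    (sum_coeff_le_sample hV hv₀ huS huN hv hinc hD hT Finset.subset_union_left hcard)
    (fun k hk => hcon.trans_le (hG.residual_anti hk.le))
  exact absurd h1 (not_le.2 (lt_stepCount hp1 ht hV hv1 (hlogs v hv1) (by linarith)
    (min_le_left _ _) (min_le_right _ _)))

end Recovery

end GreedySampling

open GreedySampling in
theorem theorem5p3 :
    ∃ C' : ℝ, 0 < C' ∧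
      ∀ (p : ℝ) [Fact (1 < p)] (t : ℝ), 0 < t → t ≤ 1 →
      ∃ c : ℝ, 1 ≤ c ∧
        ∀ (𝕜 : Type) [RCLike 𝕜] (d : ℕ) (Ω : Set (EuclideanSpace ℝ (Fin d))) [CompactSpace Ω]
          (μ : Measure Ω) [IsProbabilityMeasure μ]
          (N v₀ u S : ℕ) (_ : 1 ≤ v₀) (_ : v₀ ≤ u) (_ : u ≤ S) (_ : S ≤ N)
          (g : Fin N → C(Ω, 𝕜)) (V r : ℝ) (_ : 0 < V) (_ : 0 < r)
          (_ : Incoherent 𝕜 v₀ S V r (fun i => toLp p μ (g i)))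
          (m : ℕ) (ξ : Fin m → Ω)
          (_ : UniversalDiscretization p μ ξ (spans 𝕜 u g))
          -- the system is normalized, in one of the two norms
          (_ : ∀ i, ‖toLp p μ (g i)‖ ≤ 1 ∨ ‖toLp p (sampleMeasure ξ) (g i)‖ ≤ 1)
          (v : ℕ) (_ : 1 ≤ v) (_ : v ≤ v₀) (_ : v + stepCount p c V r v ≤ u)
          (f₀ : C(Ω, 𝕜))
          -- any realization of the WCGA for the sampled data in `L_p(Ω_m, μ_m)`
          (φ : ℕ → Fin N) (Gm : ℕ → Lp 𝕜 (ENNReal.ofReal p) (sampleMeasure ξ))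
          (_ : IsWCGA 𝕜 t (fun i => toLp p (sampleMeasure ξ) (g i))
            (toLp p (sampleMeasure ξ) f₀) φ Gm)
          -- its output after `a(v)` steps, as a linear combination of the chosen functions on `Ω`
          (G : C(Ω, 𝕜)) (_ : G ∈ chosenSpan 𝕜 g φ (stepCount p c V r v))
          (_ : toLp p (sampleMeasure ξ) G = Gm (stepCount p c V r v)),
          ‖toLp p μ f₀ - toLp p μ G‖ ≤
            C' * sigma 𝕜 v (fun i => toLp p (mixedMeasure μ ξ) (g i))
              (toLp p (mixedMeasure μ ξ) f₀) := by
  classical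
  refine ⟨22, by norm_num, fun p hp t ht _ => ⟨stepConst p t, one_le_stepConst hp.out ht, ?_⟩⟩
  intro 𝕜 _ d Ω _ μ _ N v₀ u S hv₀ hv₀u huS hSN g V r hV hr hinc m ξ hD hnorm v hv1 hv hvu f₀ φ
    Gm hG G hGmem hGeq
  have huN : u ≤ N := huS.trans hSN
  have hne : (sparse 𝕜 v (fun i => toLp p (mixedMeasure μ ξ) (g i))).Nonempty := by
    obtain ⟨J, -, hJ⟩ := Finset.exists_superset_card_eq (s := (∅ : Finset (Fin N))) (n := v)
      (by simp) (by rw [Fintype.card_fin]; omega)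
    exact ⟨0, _, ⟨J, hJ, rfl⟩, Submodule.zero_mem _⟩
  rw [mul_comm, ← div_le_iff₀ (by norm_num), sigma, Metric.le_infDist hne]
  rintro _ ⟨_, ⟨T, hT, rfl⟩, hh⟩
  obtain ⟨x, rfl⟩ := (Submodule.mem_span_image_finset_iff_exists_fun' 𝕜).1 hh
  rw [div_le_iff₀ (by norm_num), dist_eq_norm, ← toLp_sum_smul]
  set f := ∑ i ∈ T, x i • g i with hf
  set n := stepCount p (stepConst p t) V r v with hn
  obtain ⟨h1, h2⟩ := norm_toLp_le_two_mul_mixed p μ ξ (f₀ - f)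
  -- the algorithm in the discrete norm
  have h3 := norm_residual_le ht hV hr hv₀ huS huN hinc hD hnorm hv1 hv hvu hG hT x
  rw [← toLp_sum_smul, ← hf, ← hn, ← hGeq] at h3
  -- the discretization applies to `f - G`, which is a combination of at most `u` elements
  obtain ⟨c, -, hc⟩ := exists_coeff_sub_of_mem_chosenSpan (le_refl n) hGmem x T
  have hcard : (T ∪ (Finset.range n).image φ).card ≤ u := by
    refine (Finset.card_union_le _ _).trans ((Nat.add_le_add_left Finset.card_image_le _).trans ?_)
    rwa [Finset.card_range, hT]
  have h4 := le_two_mul_of_rpow_le hp.out (norm_nonneg _) (norm_nonneg _)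
    (hD.sum_bounds huN hcard c).1
  rw [hc, ← hf, toLp_sub, toLp_sub] at h4
  simp only [toLp_sub] at h1 h2
  have h5 := norm_sub_le_norm_sub_add_norm_sub (toLp p μ f₀) (toLp p μ f) (toLp p μ G)
  have h6 := norm_sub_le_norm_sub_add_norm_sub (toLp p (sampleMeasure ξ) f)
    (toLp p (sampleMeasure ξ) f₀) (toLp p (sampleMeasure ξ) G)
  rw [norm_sub_rev (toLp p (sampleMeasure ξ) f) (toLp p (sampleMeasure ξ) f₀)] at h6
  linarith
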